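/- Let $d, m \in \mathbb{N}$ and let $\bar\zeta : \mathbb{R}^d \to \mathbb{R}$ satisfy: (Z1) $\bar\zeta \in W^{1,\infty}(\mathbb{R}^d)$ (i.e. $\bar\zeta$ is bounded and Lipschitz); (Z2) $\bar\zeta$ has compact support; (Z3) $\sum_{\xi\in\mathbb{Z}^d} \bar\zeta(x-\xi)(a+b\cdot\xi) = a+b\cdot x$ for all $a\in\mathbb{R}$, $b,x\in\mathbb{R}^d$; (Z4) $\bar\zeta(0)=1$ and $\bar\zeta(\xi)=0$ for all $\xi\in\mathbb{Z}^d\setminus\{0\}$; and the symmetry $\bar\zeta(-x)=\bar\zeta(x)$ for all $x \in \mathbb{R}^d$. For $v:\mathbb{Z}^d\to\mathbb{R}^m$ put $$\bar v(x) := \sum_{\xi\in\mathbb{Z}^d} v(\xi)\,\bar\zeta(x-\xi), \qquad \tilde v(x) := (\bar\zeta*\bar v)(x)=\int_{\mathbb{R}^d}\bar\zeta(x-x')\,\bar v(x')\,\mathrm{d}x', \qquad (\mathscr{C}v)(\xi) := \tilde v(\xi) \quad (\xi\in\mathbb{Z}^d).$$ For $p\in[1,\infty)$ let $\mathscr{U}^{1,p}$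 be the set of all $u:\mathbb{Z}^d\to\mathbb{R}^m$ with $\|\nabla\bar u\|_{L^p(\mathbb{R}^d)}<\infty$. Then $\mathscr{C}:\mathscr{U}^{1,p}\to\mathscr{U}^{1,p}$ is a bijection for every $p\in[1,\infty)$, so that the smooth nodal interpolant $\tilde I u := \widetilde{\mathscr{C}^{-1}u}$ of $u\in\mathscr{U}^{1,p}$ is well defined, and there exist constants $\tilde c_0,\tilde c_1>0$, independent of $p$ and $u$, such that $$\tilde c_0\,\|\nabla\bar u\|_{L^p(\mathbb{R}^d)} \le \|\nabla\tilde I u\|_{L^p(\mathbb{R}^d)} \le \tilde c_1\,\|\nabla\bar u\|_{L^p(\mathbb{R}^d)} \qquad \forall\, u\in\mathscr{U}^{1,p},\ p\in[1,\infty).$$ -/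

import Mathlib

open MeasureTheory
open scoped ENNReal NNReal

noncomputable section

namespace LatticeInterp

/-- The lattice point `ξ ∈ ℤ^d`, viewed as a point of Euclidean space `ℝ^d`. -/
def latticePt {d : ℕ} (ξ : Fin d → ℤ) : EuclideanSpace ℝ (Fin d) :=
  WithLp.toLp 2 (fun i => (ξ i : ℝ))

/-- Vector-valued lattice functions `v : ℤ^d → ℝ^m`. -/
abbrev LatticeFun (d m : ℕ) : Type := (Fin d → ℤ) → EuclideanSpace ℝ (Fin m)

/-- The standing assumptions (Z1)-(Z4) on the nodal basis function.  A function with pointwise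
values which is compactly supported belongs to `W^{1,∞}(ℝ^d)` (through its continuous
representative) exactly if it is Lipschitz continuous. -/
structure IsNodalBasis {d : ℕ} (ζ : EuclideanSpace ℝ (Fin d) → ℝ) : Prop where
  /-- Regularity. -/
  regularity : ∃ K : ℝ≥0, LipschitzWith K ζ
  /-- Locality. -/
  locality : HasCompactSupport ζ
  /-- Order: affine functions are reproduced (each sum has finitely many nonzero terms). -/
  order : ∀ (a : ℝ) (b x : EuclideanSpace ℝ (Fin d)),
    ∑' ξ : Fin d → ℤ, ζ (x - latticePt ξ) * (a + inner ℝ b (latticePt ξ)) = a + inner ℝ b x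
  /-- Invertibility: nodal value one at the origin. -/
  nodal_zero : ζ 0 = 1
  /-- Invertibility: nodal value zero at all other lattice points. -/
  nodal_ne_zero : ∀ ξ : Fin d → ℤ, ξ ≠ 0 → ζ (latticePt ξ) = 0

/-- The interpolant `v̄(x) = ∑_ξ v(ξ) ζ(x - ξ)` (a finite sum at each `x` if `ζ` has compact
support). -/
def barInterp {d m : ℕ} (ζ : EuclideanSpace ℝ (Fin d) → ℝ) (v : LatticeFun d m)
    (x : EuclideanSpace ℝ (Fin d)) : EuclideanSpace ℝ (Fin m) :=
  ∑' ξ : Fin d → ℤ, ζ (x - latticePt ξ) • v ξ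

/-- The quasi-interpolant `ṽ = ζ ∗ v̄`. -/
def quasiInterp {d m : ℕ} (ζ : EuclideanSpace ℝ (Fin d) → ℝ) (v : LatticeFun d m)
    (x : EuclideanSpace ℝ (Fin d)) : EuclideanSpace ℝ (Fin m) :=
  ∫ y, ζ (x - y) • barInterp ζ v y

/-- The gradient norm `‖∇f‖_{L^p(ℝ^d)}`, possibly infinite.  It is applied only to locally
Lipschitz functions, which are differentiable almost everywhere with weak gradient equal to the
pointwise one. -/
def gradNorm {d m : ℕ} (p : ℝ≥0∞)
    (f : EuclideanSpace ℝ (Fin d) → EuclideanSpace ℝ (Fin m)) : ℝ≥0∞ :=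
  eLpNorm (fun x => fderiv ℝ f x) p volume

/-- The discrete homogeneous Sobolev space `U^{1,p}`: all lattice functions `u` with
`‖∇ū‖_{L^p} < ∞`.  Elements are represented by functions rather than by classes modulo
constants. -/
def discSobolev {d m : ℕ} (ζ : EuclideanSpace ℝ (Fin d) → ℝ) (p : ℝ≥0∞) :
    Set (LatticeFun d m) :=
  {u | gradNorm p (barInterp ζ u) < ⊤}

/-- The discrete convolution operator `(C u)(ξ) = ũ(ξ)`. -/
def latticeConv {d m : ℕ} (ζ : EuclideanSpace ℝ (Fin d) → ℝ) (u : LatticeFun d m) :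
    LatticeFun d m :=
  fun ξ => quasiInterp ζ u (latticePt ξ)

/-- The smooth nodal interpolant: the quasi-interpolant of `C⁻¹ u`, where `C⁻¹` is the inverse of
`C : U^{1,p} → U^{1,p}`. -/
def smoothInterp {d m : ℕ} (ζ : EuclideanSpace ℝ (Fin d) → ℝ) (p : ℝ≥0∞) (u : LatticeFun d m) :
    EuclideanSpace ℝ (Fin d) → EuclideanSpace ℝ (Fin m) :=
  quasiInterp ζ (Function.invFunOn (latticeConv ζ) (discSobolev ζ p) u)

end LatticeInterp

end

/-! By Fubini, `ṽ` is the interpolant of `v` with nodal function `ζ ∗ ζ`. Hence `C` is convolution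
on `ℤ^d` with the finitely supported sequence `a(ξ) = (ζ ∗ ζ)(ξ)`, an element of the group algebra.
Two facts carry the theorem.

Gradient norms are norms of finite differences. For a compactly supported Lipschitz `φ` whose
translates sum to a constant, the gradient of the interpolant is bounded by finitely many
differences of its coefficients (`exists_eLpNorm_fderiv_interp_le`). Conversely, differences of its
nodal values are bounded by the gradient nearby (`exists_eLpNorm_nodal_diff_le`). Near a cell only
finitely many coefficients matter, so this converse is linear algebra: a linear map vanishing on the
kernel of a seminorm is bounded by it. The local bounds are `L¹` bounds on cells of volume one, so
no constant depends on `p`.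

Convolution with `a` is invertible. By the symmetry of `ζ`, `⟨v, a ∗ v⟩ = ∫ v̄²`, and this dominates
`‖v‖²` in `ℓ²` because the values of `v̄` at lattice points are those of `v` (`exists_coercive`).
Thus `1 - θ a` is an `ℓ²` contraction for a small `θ > 0`. Applied to a delta, its powers show that
the coefficients of `(1 - θ a)^n` are at most `q^n` with `q < 1`. The supports grow only linearly in
`n`, so the `ℓ¹` norms are summable, even with weight `n + 1`. The Neumann series therefore
converges pointwise on functions with bounded differences, which grow at most linearly. It commutes
with differences and is bounded on their `ℓ^p` norms uniformly in `p`. -/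

namespace LatticeInterp

/-! ### Seminorm bounds, functions with vanishing gradient, sums of `L^p` norms -/

section General

/-- A linear map on a finite-dimensional space is bounded by the `L¹` seminorm induced by a linear
family of integrable functions, as soon as it vanishes on the kernel of that seminorm. -/
theorem exists_enorm_le_mul_lintegral {V W X G : Type*} [AddCommGroup V] [Module ℝ V]
    [FiniteDimensional ℝ V] [NormedAddCommGroup W] [NormedSpace ℝ W] [MeasurableSpace X]
    [NormedAddCommGroup G] [NormedSpace ℝ G] {μ : Measure X} (L : V →ₗ[ℝ] W) (F : V → X → G)
    (hmem : ∀ v, Integrable (F v) μ) (hadd : ∀ v w, F (v + w) =ᵐ[μ] F v + F w)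
    (hsmul : ∀ (c : ℝ) v, F (c • v) =ᵐ[μ] c • F v) (hker : ∀ v, F v =ᵐ[μ] 0 → L v = 0) :
    ∃ C : ℝ≥0, ∀ v, ‖L v‖ₑ ≤ C * ∫⁻ x, ‖F v x‖ₑ ∂μ := by
  have hm : ∀ v, MemLp (F v) 1 μ := fun v => memLp_one_iff_integrable.2 (hmem v)
  let Φ : V →ₗ[ℝ] Lp G 1 μ :=
    { toFun := fun v => (hm v).toLp
      map_add' := fun v w => by
        rw [← MemLp.toLp_add, MemLp.toLp_eq_toLp_iff]
        exact hadd v w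
      map_smul' := fun c v => by
        rw [RingHom.id_apply, ← MemLp.toLp_const_smul, MemLp.toLp_eq_toLp_iff]
        exact hsmul c v }
  have hΦker : ∀ v, Φ v = 0 → L v = 0 := fun v hv => by
    refine hker v ?_
    have h1 : (hm v).toLp = (MemLp.zero : MemLp (0 : X → G) 1 μ).toLp := by
      rw [MemLp.toLp_zero]; exact hv
    exact (MemLp.toLp_eq_toLp_iff _ _).1 h1
  -- Since `L` vanishes on the kernel of `Φ`, it factors through the range of `Φ`. That range is
  -- finite-dimensional, so the factor is automatically continuous for the `L¹` norm.
  obtain ⟨g, hg⟩ := Φ.rangeRestrict.exists_rightInverse_of_surjective (LinearMap.range_rangeRestrict Φ)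
  let L' : LinearMap.range Φ →ₗ[ℝ] W := L ∘ₗ g
  let M := LinearMap.toContinuousLinearMap L'
  have hL : ∀ v, L v = M (Φ.rangeRestrict v) := fun v => by
    have h1 : Φ.rangeRestrict (g (Φ.rangeRestrict v)) = Φ.rangeRestrict v :=
      LinearMap.congr_fun hg _
    have h2 : Φ (v - g (Φ.rangeRestrict v)) = 0 := by
      rw [map_sub, sub_eq_zero]
      exact (congrArg Subtype.val h1).symm
    have h3 := hΦker _ h2
    rw [map_sub, sub_eq_zero] at h3
    exact h3
  refine ⟨‖M‖₊, fun v => ?_⟩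
  rw [hL v, ← eLpNorm_one_eq_lintegral_enorm]
  have h1 : ‖M (Φ.rangeRestrict v)‖ₑ ≤ ‖M‖ₑ * ‖Φ.rangeRestrict v‖ₑ := M.le_opENorm _
  refine h1.trans ?_
  have h2 : ‖Φ.rangeRestrict v‖ₑ = eLpNorm (F v) 1 μ := by
    change ‖(hm v).toLp‖ₑ = _
    exact Lp.enorm_toLp (hm v)
  rw [h2]
  rfl

open Filter Topology in
/-- A Lipschitz function whose derivative vanishes almost everywhere on a ball takes the same
value everywhere in the ball as at the centre. -/
theorem eq_center_of_ae_fderiv_eq_zero {E F : Type*} [NormedAddCommGroup E] [NormedSpace ℝ E]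
    [FiniteDimensional ℝ E] [MeasurableSpace E] [BorelSpace E] [NormedAddCommGroup F]
    [NormedSpace ℝ F] [FiniteDimensional ℝ F] (μ : Measure E) [μ.IsAddHaarMeasure]
    {f : E → F} {K : ℝ≥0} (hf : LipschitzWith K f) {r : ℝ}
    (h0 : fderiv ℝ f =ᵐ[μ.restrict (Metric.ball 0 r)] 0) {v : E} (hv : ‖v‖ < r) :
    f v = f 0 := by
  have h1 : ∀ᵐ x ∂μ, x ∈ Metric.ball (0 : E) r → HasFDerivAt f (0 : E →L[ℝ] F) x := by
    rw [EventuallyEq, ae_restrict_iff' Metric.isOpen_ball.measurableSet] at h0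
    filter_upwards [h0, hf.ae_differentiableAt (μ := μ)] with x hx hd hb
    have h2 := hd.hasFDerivAt
    rwa [hx hb] at h2
  obtain ⟨s, hs2, hsm, hs1⟩ := h1.exists_measurable_mem
  -- Fubini along the direction `v`: for almost every `y`, the line `y + t v` lies in the good set
  -- for almost every `t`. On such lines `f` is constant inside the ball. These `y` are dense, and
  -- continuity then reaches `y = 0`.
  have h2 := (ae_ae_add_linearMap_mem_iff (LinearMap.toSpanSingleton ℝ E v) volume μ hsm).2
    hs2
  have hdense := Measure.dense_of_ae h2
  have hδ : 0 < r - ‖v‖ := by linarith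
  have hsub : Metric.ball (0 : E) (r - ‖v‖) ∩
      {y | ∀ᵐ t : ℝ, y + LinearMap.toSpanSingleton ℝ E v t ∈ s} ⊆ {y | f (y + v) = f y} := by
    rintro y ⟨hy, hys⟩
    rw [mem_ball_zero_iff] at hy
    simp only [Set.mem_ofPred_eq, LinearMap.toSpanSingleton_apply] at hys
    have hlip : LipschitzWith (K * ‖v‖₊) (fun t : ℝ => f (y + t • v)) := by
      refine hf.comp (LipschitzWith.of_dist_le_mul fun a b => ?_)
      rw [dist_add_left, dist_eq_norm, ← sub_smul, norm_smul, dist_eq_norm, mul_comm]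
      rfl
    have hac := (hlip.lipschitzOnWith (s := Set.uIcc 0 1)).absolutelyContinuousOnInterval
    obtain ⟨C, hC⟩ := hac.const_of_ae_hasDerivAt_zero (by
      filter_upwards [hys] with t ht htI
      rw [Set.uIcc_of_le zero_le_one] at htI
      have hmem : y + t • v ∈ Metric.ball (0 : E) r := by
        rw [mem_ball_zero_iff]
        calc ‖y + t • v‖ ≤ ‖y‖ + ‖t • v‖ := norm_add_le _ _
          _ ≤ ‖y‖ + ‖v‖ := by
            rw [norm_smul, Real.norm_of_nonneg htI.1]
            have := mul_le_mul_of_nonneg_right htI.2 (norm_nonneg v)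
            linarith
          _ < r := by linarith
      have h3 := hs1 _ ht hmem
      have h4 : HasDerivAt (fun t : ℝ => y + t • v) v t := by
        simpa using ((hasDerivAt_id t).smul_const v).const_add y
      have h5 := h3.comp_hasDerivAt t h4
      rw [zero_apply] at h5
      exact h5)
    have ha := hC 1 (by simp)
    have hb := hC 0 (by simp)
    simp only [one_smul, zero_smul, add_zero] at ha hb
    exact ha.trans hb.symm
  have hcl : IsClosed {y | f (y + v) = f y} :=
    isClosed_eq (hf.continuous.comp (continuous_id.add continuous_const)) hf.continuous
  have h5 := closure_minimal hsub hcl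
    (hdense.open_subset_closure_inter Metric.isOpen_ball (Metric.mem_ball_self hδ))
  simpa using h5

/-- A pointwise bound by a multiple of a finite sum gives the corresponding bound of
`L^p`-norms. -/
theorem eLpNorm_le_mul_sum_eLpNorm {X ι A : Type*} [MeasurableSpace X] {μ : Measure X} [ENorm A]
    {p : ℝ≥0∞} (hp : 1 ≤ p) (hp' : p ≠ ⊤) {f : X → A} {C : ℝ≥0} {S : Finset ι}
    {g : ι → X → ℝ≥0∞} (hg : ∀ i ∈ S, Measurable (g i))
    (h : ∀ x, ‖f x‖ₑ ≤ C * ∑ i ∈ S, g i x) :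
    eLpNorm f p μ ≤ C * ∑ i ∈ S, eLpNorm (g i) p μ := by
  have hp0 : p ≠ 0 := (zero_lt_one.trans_le hp).ne'
  have hpos : 0 < p.toReal := ENNReal.toReal_pos hp0 hp'
  have h1 : eLpNorm f p μ ≤ eLpNorm (fun x => (C : ℝ≥0∞) * (∑ i ∈ S, g i) x) p μ :=
    eLpNorm_mono_enorm fun x => by simpa using h x
  have h2 : eLpNorm (fun x => (C : ℝ≥0∞) * (∑ i ∈ S, g i) x) p μ
      = C * eLpNorm (∑ i ∈ S, g i) p μ := by
    rw [eLpNorm_eq_lintegral_rpow_enorm_toReal hp0 hp', eLpNorm_eq_lintegral_rpow_enorm_toReal hp0 hp']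
    simp only [enorm_eq_self, ENNReal.mul_rpow_of_nonneg _ _ hpos.le]
    rw [lintegral_const_mul' _ _ (by simp [hpos.le]), ENNReal.mul_rpow_of_nonneg _ _ (by positivity),
      ← ENNReal.rpow_mul, mul_one_div, div_self hpos.ne', ENNReal.rpow_one]
  rw [h2] at h1
  refine h1.trans ?_
  gcongr
  exact eLpNorm_sum_le (fun i hi => (hg i hi).aestronglyMeasurable) hp

end General

/-! ### Unit cells and comparison of `ℓ^p` with `L^p` -/

section Cells

variable {d : ℕ}

/-- The lattice point nearest to `x` (in every coordinate). -/
noncomputable def cellIdx (x : EuclideanSpace ℝ (Fin d)) : Fin d → ℤ := fun i => ⌊x i + 1 / 2⌋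

/-- The half-open unit cube centred at the lattice point `ξ`. -/
def cell (ξ : Fin d → ℤ) : Set (EuclideanSpace ℝ (Fin d)) := cellIdx ⁻¹' {ξ}

theorem measurable_cellIdx : Measurable (cellIdx (d := d)) := by
  unfold cellIdx
  fun_prop

theorem measurableSet_cell (ξ : Fin d → ℤ) : MeasurableSet (cell ξ) :=
  measurable_cellIdx (measurableSet_singleton ξ)

theorem volume_cell (ξ : Fin d → ℤ) : volume (cell ξ) = 1 := by
  have h := EuclideanSpace.volume_preserving_symm_measurableEquiv_toLp (Fin d)
  have hc : cell ξ = (MeasurableEquiv.toLp 2 (Fin d → ℝ)).symm ⁻¹'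
      Set.pi Set.univ (fun i => Set.Ico ((ξ i : ℝ) - 1 / 2) (ξ i + 1 / 2)) := by
    ext x
    simp only [cell, cellIdx, Set.mem_preimage, Set.mem_singleton_iff, funext_iff, Int.floor_eq_iff,
      Set.mem_pi, Set.mem_univ, true_imp_iff, Set.mem_Ico]
    refine forall_congr' fun i => ?_
    have : (MeasurableEquiv.toLp 2 (Fin d → ℝ)).symm x i = x i := rfl
    rw [this]
    constructor <;> rintro ⟨h1, h2⟩ <;> constructor <;> linarith
  rw [hc, h.measure_preimage_equiv, Real.volume_pi_Ico]
  norm_num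

theorem measurePreserving_cellIdx :
    MeasurePreserving (cellIdx (d := d)) volume Measure.count := by
  refine ⟨measurable_cellIdx, Measure.ext_of_singleton fun ξ => ?_⟩
  rw [Measure.map_apply measurable_cellIdx (measurableSet_singleton ξ), Measure.count_singleton]
  exact volume_cell ξ

theorem pairwise_disjoint_cell : Pairwise (Function.onFun Disjoint (cell (d := d))) :=
  pairwise_disjoint_fiber cellIdx

theorem iUnion_cell : ⋃ ξ, cell (d := d) ξ = Set.univ :=
  Set.eq_univ_of_forall fun x => Set.mem_iUnion.2 ⟨cellIdx x, rfl⟩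

/-- Each cell is a probability space, so its `L¹` norm is at most its `L^p` norm with constant one.
This is where uniformity in `p` comes from. -/
theorem eLpNorm_lintegral_cell_le {A : Type*} [NormedAddCommGroup A] {p : ℝ≥0∞} (hp : 1 ≤ p)
    (hp' : p ≠ ⊤) {f : EuclideanSpace ℝ (Fin d) → A} (hf : AEStronglyMeasurable f volume) :
    eLpNorm (fun ξ => ∫⁻ x in cell ξ, ‖f x‖ₑ) p Measure.count ≤ eLpNorm f p volume := by
  have hp0 : p ≠ 0 := (zero_lt_one.trans_le hp).ne'
  have hpos : 0 < p.toReal := ENNReal.toReal_pos hp0 hp'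
  rw [eLpNorm_eq_lintegral_rpow_enorm_toReal hp0 hp', eLpNorm_eq_lintegral_rpow_enorm_toReal hp0 hp']
  gcongr
  rw [lintegral_count, ← setLIntegral_univ, ← iUnion_cell,
    lintegral_iUnion measurableSet_cell pairwise_disjoint_cell]
  refine ENNReal.tsum_le_tsum fun ξ => ?_
  have : IsProbabilityMeasure (volume.restrict (cell ξ)) := ⟨by simp [volume_cell]⟩
  have h1 := eLpNorm_le_eLpNorm_of_exponent_le hp (hf.restrict (s := cell ξ))
  rw [eLpNorm_one_eq_lintegral_enorm, eLpNorm_eq_lintegral_rpow_enorm_toReal hp0 hp',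
    one_div, ENNReal.le_rpow_inv_iff hpos] at h1
  exact h1

theorem eLpNorm_count_eq {X A : Type*} [MeasurableSpace X] [MeasurableSingletonClass X] [ENorm A]
    {p : ℝ≥0∞} (hp : 1 ≤ p) (hp' : p ≠ ⊤) (f : X → A) :
    eLpNorm f p Measure.count = (∑' ξ, ‖f ξ‖ₑ ^ p.toReal) ^ (1 / p.toReal) := by
  rw [eLpNorm_eq_lintegral_rpow_enorm_toReal (zero_lt_one.trans_le hp).ne' hp', lintegral_count]

theorem eLpNorm_count_comp_add {X A : Type*} [AddGroup X] [MeasurableSpace X]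
    [MeasurableSingletonClass X] [ENorm A] {p : ℝ≥0∞} (hp : 1 ≤ p) (hp' : p ≠ ⊤)
    (f : X → A) (η : X) :
    eLpNorm (fun ξ => f (ξ + η)) p Measure.count = eLpNorm f p Measure.count := by
  rw [eLpNorm_count_eq hp hp', eLpNorm_count_eq hp hp',
    (Equiv.addRight η).tsum_eq (fun ξ => ‖f ξ‖ₑ ^ p.toReal)|>.symm]
  rfl

theorem enorm_apply_le_eLpNorm_count {X A : Type*} [MeasurableSpace X]
    [MeasurableSingletonClass X] [ENorm A] {p : ℝ≥0∞} (hp : 1 ≤ p) (hp' : p ≠ ⊤)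
    (f : X → A) (ξ : X) : ‖f ξ‖ₑ ≤ eLpNorm f p Measure.count := by
  have hpos : 0 < p.toReal := ENNReal.toReal_pos (zero_lt_one.trans_le hp).ne' hp'
  rw [eLpNorm_count_eq hp hp', one_div, ENNReal.le_rpow_inv_iff hpos]
  exact ENNReal.le_tsum ξ

end Cells

/-! ### Lattice points, finite windows and translation of cells -/

variable {d : ℕ}

theorem latticePt_add (ξ η : Fin d → ℤ) : latticePt (ξ + η) = latticePt ξ + latticePt η := by
  ext i; simp [latticePt]

theorem latticePt_sub (ξ η : Fin d → ℤ) : latticePt (ξ - η) = latticePt ξ - latticePt η := by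
  ext i; simp [latticePt]

theorem latticePt_neg (ξ : Fin d → ℤ) : latticePt (-ξ) = -latticePt ξ := by
  ext i; simp [latticePt]

@[simp] theorem latticePt_zero : latticePt (0 : Fin d → ℤ) = 0 := by
  ext i; simp [latticePt]

/-- The lattice points with all coordinates of modulus at most `N`. -/
noncomputable def window (d N : ℕ) : Finset (Fin d → ℤ) := Finset.Icc (fun _ => -(N : ℤ)) (fun _ => (N : ℤ))

theorem mem_window {N : ℕ} {ξ : Fin d → ℤ} : ξ ∈ window d N ↔ ∀ i, |ξ i| ≤ N := by
  simp only [window, Finset.mem_Icc, Pi.le_def, abs_le, forall_and]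

theorem card_window (N : ℕ) : (window d N).card = (2 * N + 1) ^ d := by
  simp only [window, Pi.card_Icc, Int.card_Icc, Finset.prod_const, Finset.card_univ,
    Fintype.card_fin]
  congr 1
  omega

theorem mem_window_of_norm_latticePt_le {N : ℕ} {ξ : Fin d → ℤ} (h : ‖latticePt ξ‖ ≤ N) :
    ξ ∈ window d N := by
  rw [mem_window]
  intro i
  have h1 := (PiLp.norm_apply_le (latticePt ξ) i).trans h
  have h2 : (latticePt ξ) i = (ξ i : ℝ) := rfl
  rw [h2, Real.norm_eq_abs] at h1
  exact_mod_cast h1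

theorem norm_sub_latticePt_cellIdx_le (x : EuclideanSpace ℝ (Fin d)) :
    ‖x - latticePt (cellIdx x)‖ ≤ d := by
  have h : ∀ i, ‖(x - latticePt (cellIdx x)) i‖ ≤ 1 := fun i => by
    have h2 : (x - latticePt (cellIdx x)) i = x i - (⌊x i + 1 / 2⌋ : ℝ) := rfl
    rw [h2, Real.norm_eq_abs, abs_le]
    have h3 := Int.floor_le (x i + 1 / 2)
    have h4 := Int.lt_floor_add_one (x i + 1 / 2)
    constructor <;> linarith
  rw [EuclideanSpace.norm_eq]
  refine Real.sqrt_le_iff.2 ⟨by positivity, ?_⟩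
  calc ∑ i, ‖(x - latticePt (cellIdx x)) i‖ ^ 2 ≤ ∑ i : Fin d, (1 : ℝ) :=
        Finset.sum_le_sum fun i _ => pow_le_one₀ (norm_nonneg _) (h i)
    _ = d := by simp
    _ ≤ (d : ℝ) ^ 2 := by
      norm_cast
      exact Nat.le_self_pow two_ne_zero d

theorem ball_subset_iUnion_cell {r : ℝ} {N : ℕ} (h : r + d ≤ N) :
    Metric.ball (0 : EuclideanSpace ℝ (Fin d)) r ⊆ ⋃ σ ∈ window d N, cell σ := by
  intro x hx
  rw [mem_ball_zero_iff] at hx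
  refine Set.mem_biUnion (x := cellIdx x) (mem_window_of_norm_latticePt_le ?_) rfl
  have h1 := norm_sub_latticePt_cellIdx_le x
  have h2 := norm_sub_norm_le (latticePt (cellIdx x)) x
  rw [norm_sub_rev] at h2
  linarith

theorem ball_subset_cell_zero : Metric.ball (0 : EuclideanSpace ℝ (Fin d)) (1 / 2) ⊆ cell 0 := by
  intro x hx
  rw [mem_ball_zero_iff] at hx
  refine funext fun i => ?_
  have h1 := (PiLp.norm_apply_le x i).trans_lt hx
  rw [Real.norm_eq_abs, abs_lt] at h1
  refine Int.floor_eq_iff.2 ?_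
  simp only [Pi.zero_apply, Int.cast_zero]
  constructor <;> linarith

theorem cellIdx_add_latticePt (x : EuclideanSpace ℝ (Fin d)) (ξ : Fin d → ℤ) :
    cellIdx (x + latticePt ξ) = cellIdx x + ξ := by
  ext i
  have : (x + latticePt ξ) i = x i + (ξ i : ℝ) := rfl
  simp only [cellIdx, this, Pi.add_apply]
  rw [add_right_comm, Int.floor_add_intCast]

/-- Translation of an integral over a cell. -/
theorem lintegral_cell_add (f : EuclideanSpace ℝ (Fin d) → ℝ≥0∞) (σ ξ : Fin d → ℤ) :
    ∫⁻ x in cell σ, f (x + latticePt ξ) = ∫⁻ x in cell (σ + ξ), f x := by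
  have h := (measurePreserving_add_right (volume : Measure (EuclideanSpace ℝ (Fin d)))
    (latticePt ξ)).setLIntegral_comp_preimage_emb
      (measurableEmbedding_addRight _) f (cell (σ + ξ))
  rw [← h]
  congr 2
  ext x
  simp [cell, cellIdx_add_latticePt]

/-! ### Interpolants with a general nodal function -/

section Interp

variable {F : Type*} [NormedAddCommGroup F] [NormedSpace ℝ F]
  {φ : EuclideanSpace ℝ (Fin d) → ℝ} {K : ℝ≥0} {R : ℕ}

/-- The interpolant of a lattice function with values in a general normed space, with an arbitrary
nodal function `φ`. -/
noncomputable def interp (φ : EuclideanSpace ℝ (Fin d) → ℝ) (w : (Fin d → ℤ) → F)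
    (x : EuclideanSpace ℝ (Fin d)) : F :=
  ∑' ξ, φ (x - latticePt ξ) • w ξ

theorem apply_sub_latticePt_eq_zero (hR : ∀ x, (R : ℝ) ≤ ‖x‖ → φ x = 0) {N : ℕ}
    {x : EuclideanSpace ℝ (Fin d)} (hx : ‖x‖ + R ≤ N) {ξ : Fin d → ℤ} (hξ : ξ ∉ window d N) :
    φ (x - latticePt ξ) = 0 := by
  refine hR _ ?_
  by_contra! h
  refine hξ (mem_window_of_norm_latticePt_le ?_)
  have h2 := norm_sub_norm_le (latticePt ξ) x
  rw [norm_sub_rev] at h2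
  linarith

theorem interp_eq_sum (hR : ∀ x, (R : ℝ) ≤ ‖x‖ → φ x = 0) (w : (Fin d → ℤ) → F) {N : ℕ}
    {x : EuclideanSpace ℝ (Fin d)} (hx : ‖x‖ + R ≤ N) :
    interp φ w x = ∑ ξ ∈ window d N, φ (x - latticePt ξ) • w ξ :=
  tsum_eq_sum fun ξ hξ => by rw [apply_sub_latticePt_eq_zero hR hx hξ, zero_smul]

theorem interp_add_latticePt (φ : EuclideanSpace ℝ (Fin d) → ℝ) (w : (Fin d → ℤ) → F)
    (x : EuclideanSpace ℝ (Fin d)) (η : Fin d → ℤ) :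
    interp φ w (x + latticePt η) = interp φ (fun ξ => w (ξ + η)) x := by
  unfold interp
  rw [← (Equiv.addRight η).tsum_eq]
  refine tsum_congr fun ξ => ?_
  simp only [Equiv.coe_addRight, latticePt_add, add_sub_add_right_eq_sub]

theorem fderiv_interp_add_latticePt (φ : EuclideanSpace ℝ (Fin d) → ℝ) (w : (Fin d → ℤ) → F)
    (x : EuclideanSpace ℝ (Fin d)) (η : Fin d → ℤ) :
    fderiv ℝ (interp φ w) (x + latticePt η) = fderiv ℝ (interp φ (fun ξ => w (ξ + η))) x := by
  rw [← fderiv_comp_add_right]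
  simp only [interp_add_latticePt]

/-- The interpolant of a lattice function supported in a window. -/
noncomputable def windowInterp (φ : EuclideanSpace ℝ (Fin d) → ℝ) (N : ℕ) (v : window d N → F)
    (x : EuclideanSpace ℝ (Fin d)) : F :=
  ∑ ξ : window d N, φ (x - latticePt ξ) • v ξ

theorem interp_eq_windowInterp (hR : ∀ x, (R : ℝ) ≤ ‖x‖ → φ x = 0) (w : (Fin d → ℤ) → F) {N : ℕ}
    {x : EuclideanSpace ℝ (Fin d)} (hx : ‖x‖ + R ≤ N) :
    interp φ w x = windowInterp φ N (fun ξ => w ξ) x := by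
  rw [interp_eq_sum hR w hx, windowInterp,
    Finset.sum_coe_sort (window d N) (fun ξ => φ (x - latticePt ξ) • w ξ)]

theorem exists_lipschitzWith_windowInterp (hφ : LipschitzWith K φ) (N : ℕ) (v : window d N → F) :
    ∃ K' : ℝ≥0, LipschitzWith K' (windowInterp φ N v) := by
  refine ⟨∑ ξ, K * ‖v ξ‖₊, LipschitzWith.of_dist_le_mul fun x y => ?_⟩
  simp only [windowInterp, dist_eq_norm, ← Finset.sum_sub_distrib, ← sub_smul]
  refine (norm_sum_le _ _).trans ?_
  push_cast
  rw [Finset.sum_mul]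
  refine Finset.sum_le_sum fun ξ _ => ?_
  rw [norm_smul, mul_right_comm]
  gcongr
  have := hφ.dist_le_mul (x - latticePt ξ) (y - latticePt ξ)
  simpa [dist_eq_norm] using this

theorem windowInterp_add (φ : EuclideanSpace ℝ (Fin d) → ℝ) (N : ℕ) (v w : window d N → F) :
    windowInterp φ N (v + w) = windowInterp φ N v + windowInterp φ N w := by
  ext x
  simp [windowInterp, Finset.sum_add_distrib]

theorem windowInterp_smul (φ : EuclideanSpace ℝ (Fin d) → ℝ) (N : ℕ) (c : ℝ) (v : window d N → F) :
    windowInterp φ N (c • v) = c • windowInterp φ N v := by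
  ext x
  simp [windowInterp, Finset.smul_sum, smul_comm c]

theorem continuous_interp (hφ : LipschitzWith K φ) (hR : ∀ x, (R : ℝ) ≤ ‖x‖ → φ x = 0)
    (w : (Fin d → ℤ) → F) : Continuous (interp φ w) := by
  rw [continuous_iff_continuousAt]
  intro x
  obtain ⟨N, hN⟩ := exists_nat_ge (‖x‖ + 1 + R)
  obtain ⟨K', hK'⟩ := exists_lipschitzWith_windowInterp hφ N (fun ξ => w ξ)
  refine hK'.continuous.continuousAt.congr ?_
  filter_upwards [Metric.ball_mem_nhds x one_pos] with y hy
  refine (interp_eq_windowInterp hR w ?_).symm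
  have := norm_sub_norm_le y x
  rw [Metric.mem_ball, dist_eq_norm] at hy
  linarith

/-- The window extension of the interpolant determines the derivative on a ball. -/
theorem fderiv_interp_eq_windowInterp (hR : ∀ x, (R : ℝ) ≤ ‖x‖ → φ x = 0) (w : (Fin d → ℤ) → F)
    {N : ℕ} {r : ℝ} (hr : r + R ≤ N) {x : EuclideanSpace ℝ (Fin d)} (hx : ‖x‖ < r) :
    fderiv ℝ (interp φ w) x = fderiv ℝ (windowInterp φ N (fun ξ => w ξ)) x := by
  refine Filter.EventuallyEq.fderiv_eq ?_
  filter_upwards [Metric.isOpen_ball.mem_nhds (mem_ball_zero_iff.2 hx)] with y hy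
  rw [mem_ball_zero_iff] at hy
  exact interp_eq_windowInterp hR w (by linarith)

/-- Differences of nodal values are controlled by the gradient nearby. -/
theorem exists_enorm_sub_le_lintegral_fderiv (F : Type*) [NormedAddCommGroup F] [NormedSpace ℝ F]
    [FiniteDimensional ℝ F] (hφ : LipschitzWith K φ)
    (hR : ∀ x, (R : ℝ) ≤ ‖x‖ → φ x = 0) (ρ : Fin d → ℤ) :
    ∃ (C : ℝ≥0) (S : Finset (Fin d → ℤ)), ∀ w : (Fin d → ℤ) → F,
      ‖interp φ w (latticePt ρ) - interp φ w 0‖ₑ ≤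
        C * ∑ σ ∈ S, ∫⁻ x in cell σ, ‖fderiv ℝ (interp φ w) x‖ₑ := by
  -- The ball contains both `0` and `ρ`. The window of size `N` holds every node that influences it,
  -- and the cells indexed by the window of size `M` cover it.
  set r : ℝ := ‖latticePt ρ‖ + 1 with hr
  have hr0 : 0 < r := by positivity
  obtain ⟨N, hN⟩ := exists_nat_ge (r + R)
  obtain ⟨M, hM⟩ := exists_nat_ge (r + d)
  have hdiff : ∀ v : window d N → F,
      ∀ᵐ x ∂volume.restrict (Metric.ball (0 : EuclideanSpace ℝ (Fin d)) r),
        DifferentiableAt ℝ (windowInterp φ N v) x := fun v => by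
    obtain ⟨K', hK'⟩ := exists_lipschitzWith_windowInterp hφ N v
    exact ae_restrict_of_ae hK'.ae_differentiableAt
  let L : (window d N → F) →ₗ[ℝ] F :=
    { toFun := fun v => windowInterp φ N v (latticePt ρ) - windowInterp φ N v 0
      map_add' := fun v w => by
        simp only [windowInterp_add, Pi.add_apply]
        abel
      map_smul' := fun c v => by
        simp only [windowInterp_smul, Pi.smul_apply, RingHom.id_apply, smul_sub] }
  obtain ⟨C, hC⟩ := exists_enorm_le_mul_lintegral
    (μ := volume.restrict (Metric.ball (0 : EuclideanSpace ℝ (Fin d)) r)) L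
    (fun v => fderiv ℝ (windowInterp φ N v))
    (fun v => by
      obtain ⟨K', hK'⟩ := exists_lipschitzWith_windowInterp hφ N v
      refine Measure.integrableOn_of_bounded (M := K') (measure_ball_lt_top).ne
        (measurable_fderiv ℝ _).aestronglyMeasurable
        (Filter.Eventually.of_forall fun x => norm_fderiv_le_of_lipschitz ℝ hK'))
    (fun v w => by
      filter_upwards [hdiff v, hdiff w] with x h1 h2
      rw [windowInterp_add, fderiv_add h1 h2, Pi.add_apply])
    (fun c v => by
      filter_upwards [hdiff v] with x h1
      rw [windowInterp_smul, fderiv_const_smul h1, Pi.smul_apply])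
    (fun v hv => by
      obtain ⟨K', hK'⟩ := exists_lipschitzWith_windowInterp hφ N v
      exact sub_eq_zero.2 (eq_center_of_ae_fderiv_eq_zero volume hK' hv (by rw [hr]; linarith)))
  refine ⟨C, window d M, fun w => ?_⟩
  have h1 := hC (fun ξ => w ξ)
  have h2 : L (fun ξ => w ξ) = interp φ w (latticePt ρ) - interp φ w 0 := by
    rw [interp_eq_windowInterp hR w (N := N) (x := 0) (by rw [norm_zero]; linarith),
      interp_eq_windowInterp hR w (N := N) (x := latticePt ρ) (by linarith)]
    rfl
  rw [h2] at h1
  refine h1.trans ?_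
  gcongr
  calc ∫⁻ x in Metric.ball (0 : EuclideanSpace ℝ (Fin d)) r,
          ‖fderiv ℝ (windowInterp φ N fun ξ => w ξ) x‖ₑ
      = ∫⁻ x in Metric.ball (0 : EuclideanSpace ℝ (Fin d)) r, ‖fderiv ℝ (interp φ w) x‖ₑ := by
        refine setLIntegral_congr_fun Metric.isOpen_ball.measurableSet fun x hx => ?_
        rw [fderiv_interp_eq_windowInterp hR w hN (mem_ball_zero_iff.1 hx)]
    _ ≤ ∫⁻ x in ⋃ σ ∈ window d M, cell σ, ‖fderiv ℝ (interp φ w) x‖ₑ :=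
        lintegral_mono_set (ball_subset_iUnion_cell hM)
    _ = ∑ σ ∈ window d M, ∫⁻ x in cell σ, ‖fderiv ℝ (interp φ w) x‖ₑ :=
        lintegral_biUnion_finset (fun _ _ _ _ h => pairwise_disjoint_cell h)
          (fun σ _ => measurableSet_cell σ) _

/-- Finite differences of nodal values are controlled in `ℓ^p` by the `L^p`-norm of the gradient,
uniformly in `p`. -/
theorem exists_eLpNorm_nodal_diff_le (F : Type*) [NormedAddCommGroup F] [NormedSpace ℝ F]
    [FiniteDimensional ℝ F] (hφ : LipschitzWith K φ)
    (hR : ∀ x, (R : ℝ) ≤ ‖x‖ → φ x = 0) (ρ : Fin d → ℤ) :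
    ∃ C : ℝ≥0, ∀ p : ℝ≥0∞, 1 ≤ p → p ≠ ⊤ → ∀ w : (Fin d → ℤ) → F,
      eLpNorm (fun ξ => interp φ w (latticePt (ξ + ρ)) - interp φ w (latticePt ξ)) p
        Measure.count ≤ C * eLpNorm (fderiv ℝ (interp φ w)) p volume := by
  obtain ⟨C, S, hC⟩ := exists_enorm_sub_le_lintegral_fderiv F hφ hR ρ
  -- Each cell of `S` contributes the same `ℓ^p` norm, by translation invariance.
  refine ⟨C * S.card, fun p hp hp' w => ?_⟩
  set g : (Fin d → ℤ) → ℝ≥0∞ := fun ξ => ∫⁻ x in cell ξ, ‖fderiv ℝ (interp φ w) x‖ₑ with hg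
  refine (eLpNorm_le_mul_sum_eLpNorm hp hp' (C := C) (S := S) (g := fun σ ξ => g (ξ + σ))
    (fun _ _ => measurable_of_countable _) fun ξ => ?_).trans ?_
  · have h := hC (fun η => w (η + ξ))
    rw [← interp_add_latticePt, ← interp_add_latticePt, zero_add, ← latticePt_add] at h
    simp only [← fderiv_interp_add_latticePt] at h
    rw [add_comm ξ ρ]
    refine h.trans (le_of_eq ?_)
    congr 1
    refine Finset.sum_congr rfl fun σ _ => ?_
    rw [lintegral_cell_add (fun x => ‖fderiv ℝ (interp φ w) x‖ₑ), hg, add_comm]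
  · simp only [eLpNorm_count_comp_add hp hp', Finset.sum_const, nsmul_eq_mul]
    push_cast
    rw [mul_assoc]
    gcongr
    exact eLpNorm_lintegral_cell_le hp hp' (measurable_fderiv ℝ _).aestronglyMeasurable

/-- The gradient of the interpolant is controlled by finite differences, uniformly in `p`. -/
theorem exists_eLpNorm_fderiv_interp_le (hφ : LipschitzWith K φ)
    (hR : ∀ x, (R : ℝ) ≤ ‖x‖ → φ x = 0) {s : ℝ} (hs : ∀ x, ∑' ξ, φ (x - latticePt ξ) = s) :
    ∃ N : ℕ, ∀ p : ℝ≥0∞, 1 ≤ p → p ≠ ⊤ → ∀ w : (Fin d → ℤ) → F,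
      eLpNorm (fderiv ℝ (interp φ w)) p volume ≤
        K * ∑ ρ ∈ window d N, eLpNorm (fun ξ => w (ξ + ρ) - w ξ) p Measure.count := by
  have hR' : ((d + 1 : ℕ) : ℝ) + R ≤ (d + 1 + R : ℕ) := by push_cast; rfl
  set N := d + 1 + R with hN
  refine ⟨N, fun p hp hp' w => ?_⟩
  have key : ∀ x : EuclideanSpace ℝ (Fin d), ‖fderiv ℝ (interp φ w) x‖ₑ ≤
      K * ∑ ρ ∈ window d N, ‖w (cellIdx x + ρ) - w (cellIdx x)‖ₑ := by
    intro x
    obtain ⟨y, η, hy, hη, rfl⟩ : ∃ (y : EuclideanSpace ℝ (Fin d)) (η : Fin d → ℤ),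
        ‖y‖ < ((d + 1 : ℕ) : ℝ) ∧ cellIdx x = η ∧ x = y + latticePt η := by
      refine ⟨x - latticePt (cellIdx x), cellIdx x, ?_, rfl, by abel⟩
      have := norm_sub_latticePt_cellIdx_le x
      push_cast
      linarith
    rw [hη, fderiv_interp_add_latticePt]
    have hLip : LipschitzOnWith (K * ∑ ρ ∈ window d N, ‖w (η + ρ) - w η‖₊)
        (interp φ fun ξ => w (ξ + η)) (Metric.ball 0 ((d + 1 : ℕ) : ℝ)) := by
      -- The translates of `φ` sum to `s`, so the value at the central node splits off as a constant
      -- and only differences contribute to the gradient.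
      have hrep : ∀ z ∈ Metric.ball (0 : EuclideanSpace ℝ (Fin d)) ((d + 1 : ℕ) : ℝ),
          interp φ (fun ξ => w (ξ + η)) z =
            s • w η + ∑ ρ ∈ window d N, φ (z - latticePt ρ) • (w (η + ρ) - w η) := by
        intro z hz
        rw [mem_ball_zero_iff] at hz
        have hz' : ‖z‖ + R ≤ N := by linarith
        have h1 : ∑ ξ ∈ window d N, φ (z - latticePt ξ) = s := by
          rw [← hs z]
          exact (tsum_eq_sum fun ξ hξ => apply_sub_latticePt_eq_zero hR hz' hξ).symm
        rw [interp_eq_sum hR _ hz', ← h1, Finset.sum_smul, ← Finset.sum_add_distrib]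
        refine Finset.sum_congr rfl fun ρ _ => ?_
        rw [← smul_add, add_sub_cancel, add_comm]
      refine LipschitzOnWith.of_dist_le_mul fun a ha b hb => ?_
      rw [hrep a ha, hrep b hb, dist_add_left, dist_eq_norm, ← Finset.sum_sub_distrib]
      simp only [← sub_smul]
      refine (norm_sum_le _ _).trans ?_
      push_cast
      rw [mul_right_comm, Finset.mul_sum]
      refine Finset.sum_le_sum fun ρ _ => ?_
      rw [norm_smul]
      gcongr
      have := hφ.dist_le_mul (a - latticePt ρ) (b - latticePt ρ)
      simpa [dist_eq_norm] using this
    have h2 := norm_fderiv_le_of_lipschitzOn ℝ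
      (Metric.isOpen_ball.mem_nhds (mem_ball_zero_iff.2 hy)) hLip
    have h3 : ‖fderiv ℝ (interp φ fun ξ => w (ξ + η)) y‖₊ ≤
      K * ∑ ρ ∈ window d N, ‖w (η + ρ) - w η‖₊ := h2
    rw [enorm_eq_nnnorm]
    refine (ENNReal.coe_le_coe.2 h3).trans (le_of_eq ?_)
    push_cast
    rfl
  refine (eLpNorm_le_mul_sum_eLpNorm hp hp' (C := K) (S := window d N)
    (g := fun ρ x => ‖w (cellIdx x + ρ) - w (cellIdx x)‖ₑ) (fun ρ _ => ?_) key).trans (le_of_eq ?_)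
  · exact (measurable_of_countable
      (fun ξ : Fin d → ℤ => ‖w (ξ + ρ) - w ξ‖ₑ)).comp measurable_cellIdx
  · congr 1
    refine Finset.sum_congr rfl fun ρ _ => ?_
    have h := eLpNorm_comp_measurePreserving (p := p)
      (measurable_of_countable (fun ξ : Fin d → ℤ => ‖w (ξ + ρ) - w ξ‖ₑ)).aestronglyMeasurable
      (measurePreserving_cellIdx (d := d))
    exact h.trans (eLpNorm_enorm _)

end Interp

/-! ### The quasi-interpolant as interpolation with `φ ∗ φ` -/

section SelfConv

variable {F : Type*} [NormedAddCommGroup F] [NormedSpace ℝ F]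
  {φ : EuclideanSpace ℝ (Fin d) → ℝ} {K : ℝ≥0} {R : ℕ}

/-- The convolution `φ ∗ φ`. -/
noncomputable def selfConv (φ : EuclideanSpace ℝ (Fin d) → ℝ) (x : EuclideanSpace ℝ (Fin d)) : ℝ :=
  ∫ y, φ (x - y) * φ y

theorem hasCompactSupport_of_norm_le {A : Type*} [Zero A] {f : EuclideanSpace ℝ (Fin d) → A}
    {r : ℝ} (hr : ∀ x, r ≤ ‖x‖ → f x = 0) : HasCompactSupport f :=
  HasCompactSupport.intro (isCompact_closedBall 0 r) fun x hx => hr x (by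
    rw [mem_closedBall_zero_iff, not_le] at hx
    exact hx.le)

theorem integrable_of_norm_le {A : Type*} [NormedAddCommGroup A]
    {f : EuclideanSpace ℝ (Fin d) → A} (hf : Continuous f)
    {r : ℝ} (hr : ∀ x, r ≤ ‖x‖ → f x = 0) : Integrable f :=
  hf.integrable_of_hasCompactSupport (hasCompactSupport_of_norm_le hr)

theorem integrable_translate_mul (hφ : LipschitzWith K φ) (hR : ∀ x, (R : ℝ) ≤ ‖x‖ → φ x = 0)
    {g : EuclideanSpace ℝ (Fin d) → ℝ} (hg : Continuous g) (x : EuclideanSpace ℝ (Fin d)) :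
    Integrable fun y => φ (x - y) * g y := by
  refine integrable_of_norm_le (r := ‖x‖ + R)
    ((hφ.continuous.comp (continuous_const.sub continuous_id)).mul hg) fun y hy => ?_
  rw [hR, zero_mul]
  have := norm_sub_norm_le y x
  rw [norm_sub_rev] at this
  linarith

theorem selfConv_eq_zero (hR : ∀ x, (R : ℝ) ≤ ‖x‖ → φ x = 0) (x : EuclideanSpace ℝ (Fin d))
    (hx : ((2 * R : ℕ) : ℝ) ≤ ‖x‖) : selfConv φ x = 0 := by
  refine integral_eq_zero_of_ae (Filter.Eventually.of_forall fun y => ?_)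
  change φ (x - y) * φ y = 0
  by_cases hy : (R : ℝ) ≤ ‖y‖
  · rw [hR y hy, mul_zero]
  · rw [hR (x - y), zero_mul]
    have := norm_sub_norm_le x y
    push_cast at hx
    linarith

theorem exists_lipschitzWith_selfConv (hφ : LipschitzWith K φ)
    (hR : ∀ x, (R : ℝ) ≤ ‖x‖ → φ x = 0) : ∃ K' : ℝ≥0, LipschitzWith K' (selfConv φ) := by
  refine ⟨K * ⟨∫ y, ‖φ y‖, integral_nonneg fun _ => norm_nonneg _⟩,
    LipschitzWith.of_dist_le_mul fun x z => ?_⟩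
  rw [dist_eq_norm, selfConv, selfConv, ← integral_sub
    (integrable_translate_mul hφ hR hφ.continuous x) (integrable_translate_mul hφ hR hφ.continuous z)]
  have hint := (integrable_of_norm_le hφ.continuous hR).norm
  refine (norm_integral_le_of_norm_le (hint.const_mul (K * dist x z))
    (Filter.Eventually.of_forall fun y => ?_)).trans (le_of_eq ?_)
  · rw [← sub_mul, norm_mul]
    gcongr
    have := hφ.dist_le_mul (x - y) (z - y)
    simpa [dist_eq_norm] using this
  · rw [integral_const_mul]
    change _ = K * (∫ y, ‖φ y‖) * dist x z
    ring

/-- Convolving the interpolant with its nodal function amounts to interpolating with `φ ∗ φ`. -/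
theorem integral_smul_interp (hφ : LipschitzWith K φ) (hR : ∀ x, (R : ℝ) ≤ ‖x‖ → φ x = 0)
    [CompleteSpace F] (w : (Fin d → ℤ) → F) (x : EuclideanSpace ℝ (Fin d)) :
    ∫ y, φ (x - y) • interp φ w y = interp (selfConv φ) w x := by
  -- The factor `φ (x - y)` restricts `y` to norm at most `‖x‖ + R`; the interpolant at such `y`
  -- involves only nodes within another `R`.
  obtain ⟨N, hN⟩ := exists_nat_ge (‖x‖ + 2 * R)
  have h1 : ∀ y, φ (x - y) • interp φ w y =
      ∑ ξ ∈ window d N, (φ (x - y) * φ (y - latticePt ξ)) • w ξ := by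
    intro y
    by_cases hy : (R : ℝ) ≤ ‖x - y‖
    · simp [hR _ hy]
    · have h2 := norm_sub_norm_le y x
      rw [norm_sub_rev] at h2
      rw [interp_eq_sum hR w (N := N) (by linarith), Finset.smul_sum]
      simp only [smul_smul]
  simp only [h1]
  rw [integral_finsetSum, interp_eq_sum (selfConv_eq_zero hR) w (N := N) (by push_cast; exact hN)]
  · refine Finset.sum_congr rfl fun ξ _ => ?_
    rw [integral_smul_const]
    congr 1
    rw [selfConv, ← integral_sub_right_eq_self (fun y => φ (x - latticePt ξ - y) * φ y) (latticePt ξ)]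
    simp only [sub_sub_sub_cancel_right]
  · intro ξ _
    exact (integrable_translate_mul hφ hR
      (hφ.continuous.comp (continuous_id.sub continuous_const)) x).smul_const _

/-- Convolve the interpolant of the constant one, which is the constant `s`. This makes the gradient
bound by differences available for `φ ∗ φ`. -/
theorem tsum_selfConv (hφ : LipschitzWith K φ) (hR : ∀ x, (R : ℝ) ≤ ‖x‖ → φ x = 0)
    {s : ℝ} (hs : ∀ x, ∑' ξ, φ (x - latticePt ξ) = s) (x : EuclideanSpace ℝ (Fin d)) :
    ∑' ξ, selfConv φ (x - latticePt ξ) = (∫ y, φ y) * s := by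
  have h := integral_smul_interp hφ hR (fun _ : Fin d → ℤ => (1 : ℝ)) x
  simp only [interp, smul_eq_mul, mul_one, hs] at h
  rw [← h, integral_mul_const, integral_sub_left_eq_self φ volume x]

end SelfConv

/-! ### Coercivity in `ℓ²` -/

section Coercive

variable {F : Type*} [NormedAddCommGroup F] [NormedSpace ℝ F]
  {φ : EuclideanSpace ℝ (Fin d) → ℝ} {K : ℝ≥0} {R : ℕ}

theorem interp_latticePt (h0 : φ 0 = 1) (h1 : ∀ ξ : Fin d → ℤ, ξ ≠ 0 → φ (latticePt ξ) = 0)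
    (w : (Fin d → ℤ) → F) (ξ : Fin d → ℤ) : interp φ w (latticePt ξ) = w ξ := by
  rw [interp, tsum_eq_single ξ fun η hη => ?_]
  · rw [sub_self, h0, one_smul]
  · rw [← latticePt_sub, h1 _ (sub_ne_zero.2 hη.symm), zero_smul]

/-- Only finitely many coefficients matter on a small ball, and a continuous interpolant vanishing
almost everywhere there also vanishes at the centre. The general seminorm bound then applies. -/
theorem exists_enorm_nodal_le_lintegral (F : Type*) [NormedAddCommGroup F] [NormedSpace ℝ F]
    [FiniteDimensional ℝ F] (hφ : LipschitzWith K φ) (hR : ∀ x, (R : ℝ) ≤ ‖x‖ → φ x = 0) :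
    ∃ C : ℝ≥0, ∀ w : (Fin d → ℤ) → F, ‖interp φ w 0‖ₑ ≤ C * ∫⁻ x in cell 0, ‖interp φ w x‖ₑ := by
  set B := Metric.ball (0 : EuclideanSpace ℝ (Fin d)) (1 / 2) with hB
  have hcont : ∀ v : window d (1 + R) → F, Continuous (windowInterp φ (1 + R) v) := fun v =>
    let ⟨_, hK'⟩ := exists_lipschitzWith_windowInterp hφ (1 + R) v
    hK'.continuous
  let L : (window d (1 + R) → F) →ₗ[ℝ] F :=
    { toFun := fun v => windowInterp φ (1 + R) v 0
      map_add' := fun v w => by simp only [windowInterp_add, Pi.add_apply]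
      map_smul' := fun c v => by simp only [windowInterp_smul, Pi.smul_apply, RingHom.id_apply] }
  obtain ⟨C, hC⟩ := exists_enorm_le_mul_lintegral (μ := volume.restrict B) L
    (fun v => windowInterp φ (1 + R) v)
    (fun v => ((hcont v).continuousOn.integrableOn_compact
      (isCompact_closedBall 0 (1 / 2))).mono_set Metric.ball_subset_closedBall)
    (fun v w => by rw [windowInterp_add])
    (fun c v => by rw [windowInterp_smul])
    (fun v hv => Measure.eqOn_open_of_ae_eq hv Metric.isOpen_ball (hcont v).continuousOn
      continuousOn_const (Metric.mem_ball_self (by norm_num)))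
  refine ⟨C, fun w => ?_⟩
  have h1 := hC (fun ξ => w ξ)
  have heq : ∀ x ∈ B, windowInterp φ (1 + R) (fun ξ => w ξ) x = interp φ w x := fun x hx =>
    (interp_eq_windowInterp hR w (by
      rw [hB, mem_ball_zero_iff] at hx
      push_cast
      linarith)).symm
  have h2 : L (fun ξ => w ξ) = interp φ w 0 := heq 0 (Metric.mem_ball_self (by norm_num))
  rw [h2] at h1
  refine h1.trans ?_
  refine mul_le_mul' le_rfl ?_
  rw [setLIntegral_congr_fun (g := fun x => ‖interp φ w x‖ₑ) Metric.isOpen_ball.measurableSet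
    fun x hx => by rw [heq x hx]]
  exact lintegral_mono_set ball_subset_cell_zero

/-- The nodal values are controlled by the interpolant. -/
theorem exists_eLpNorm_le_eLpNorm_interp (F : Type*) [NormedAddCommGroup F] [NormedSpace ℝ F]
    [FiniteDimensional ℝ F] (hφ : LipschitzWith K φ) (hR : ∀ x, (R : ℝ) ≤ ‖x‖ → φ x = 0)
    (h0 : φ 0 = 1) (hne : ∀ ξ : Fin d → ℤ, ξ ≠ 0 → φ (latticePt ξ) = 0) :
    ∃ C : ℝ≥0, ∀ p : ℝ≥0∞, 1 ≤ p → p ≠ ⊤ → ∀ w : (Fin d → ℤ) → F,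
      eLpNorm w p Measure.count ≤ C * eLpNorm (interp φ w) p volume := by
  obtain ⟨C, hC⟩ := exists_enorm_nodal_le_lintegral F hφ hR
  refine ⟨C, fun p hp hp' w => ?_⟩
  refine (eLpNorm_le_mul_sum_eLpNorm hp hp' (C := C) (S := {()})
    (g := fun _ ξ => ∫⁻ x in cell ξ, ‖interp φ w x‖ₑ)
    (fun _ _ => measurable_of_countable _) fun ξ => ?_).trans ?_
  · have h := hC (fun η => w (η + ξ))
    rw [← interp_add_latticePt, zero_add, interp_latticePt h0 hne] at h
    simp only [← interp_add_latticePt] at h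
    rw [lintegral_cell_add (fun x => ‖interp φ w x‖ₑ), zero_add] at h
    simpa using h
  · rw [Finset.sum_singleton]
    gcongr
    exact eLpNorm_lintegral_cell_le hp hp' (continuous_interp hφ hR w).aestronglyMeasurable

/-- Expand one factor of the square. Evenness turns `φ (x - ξ)` into `φ (ξ - x)`, so the integral
becomes a convolution evaluated at `ξ`. -/
theorem integral_sq_interp (hφ : LipschitzWith K φ) (hR : ∀ x, (R : ℝ) ≤ ‖x‖ → φ x = 0)
    (hsymm : ∀ x, φ (-x) = φ x) {v : (Fin d → ℤ) → ℝ} {S : Finset (Fin d → ℤ)}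
    (hS : ∀ ξ ∉ S, v ξ = 0) :
    Integrable (fun x => interp φ v x ^ 2) ∧
      ∫ x, interp φ v x ^ 2 = ∑ ξ ∈ S, v ξ * interp (selfConv φ) v (latticePt ξ) := by
  have h1 : ∀ x, interp φ v x ^ 2 =
      ∑ ξ ∈ S, v ξ * (φ (latticePt ξ - x) * interp φ v x) := by
    intro x
    have h2 : interp φ v x = ∑ ξ ∈ S, φ (x - latticePt ξ) • v ξ :=
      tsum_eq_sum fun ξ hξ => by rw [hS ξ hξ, smul_zero]
    rw [sq]
    nth_rw 1 [h2]
    rw [Finset.sum_mul]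
    refine Finset.sum_congr rfl fun ξ _ => ?_
    rw [← hsymm, neg_sub, smul_eq_mul]
    ring
  have hint : ∀ ξ ∈ S, Integrable fun x => v ξ * (φ (latticePt ξ - x) * interp φ v x) :=
    fun ξ _ => (integrable_translate_mul hφ hR (continuous_interp hφ hR v) _).const_mul _
  simp only [h1]
  refine ⟨integrable_finsetSum S hint, ?_⟩
  rw [integral_finsetSum _ hint]
  refine Finset.sum_congr rfl fun ξ _ => ?_
  rw [integral_const_mul, ← integral_smul_interp hφ hR]
  rfl

/-- Coercivity in `ℓ²` of the convolution with the nodal values of `φ ∗ φ`. -/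
theorem exists_coercive (hφ : LipschitzWith K φ) (hR : ∀ x, (R : ℝ) ≤ ‖x‖ → φ x = 0)
    (hsymm : ∀ x, φ (-x) = φ x) (h0 : φ 0 = 1)
    (hne : ∀ ξ : Fin d → ℤ, ξ ≠ 0 → φ (latticePt ξ) = 0) :
    ∃ c : ℝ, 0 < c ∧ ∀ (v : (Fin d → ℤ) → ℝ) (S : Finset (Fin d → ℤ)), (∀ ξ ∉ S, v ξ = 0) →
      c * ∑ ξ ∈ S, v ξ ^ 2 ≤ ∑ ξ ∈ S, v ξ * interp (selfConv φ) v (latticePt ξ) := by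
  obtain ⟨C, hC⟩ := exists_eLpNorm_le_eLpNorm_interp ℝ hφ hR h0 hne
  -- Squaring the `ℓ²` bound gives the constant `C ^ 2`; adding one keeps it invertible when `C =
  -- 0`.
  refine ⟨((C : ℝ) ^ 2 + 1)⁻¹, by positivity, fun v S hS => ?_⟩
  obtain ⟨hint, heq⟩ := integral_sq_interp hφ hR hsymm hS
  rw [← heq, inv_mul_le_iff₀ (by positivity)]
  have h1 := hC 2 (by norm_num) (by norm_num) v
  have h2 := ENNReal.rpow_le_rpow h1 (z := 2) (by norm_num)
  rw [ENNReal.mul_rpow_of_nonneg _ _ (by norm_num),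
    eLpNorm_eq_lintegral_rpow_enorm_toReal (by norm_num) (by norm_num),
    eLpNorm_eq_lintegral_rpow_enorm_toReal (by norm_num) (by norm_num), lintegral_count] at h2
  have hsq : ∀ a : ℝ≥0∞, (a ^ (1 / (2 : ℝ))) ^ (2 : ℝ) = a := fun a => by
    rw [← ENNReal.rpow_mul, one_div_mul_cancel two_ne_zero, ENNReal.rpow_one]
  simp only [ENNReal.toReal_ofNat, hsq] at h2
  simp only [ENNReal.rpow_ofNat] at h2
  have h3 : ∀ a : ℝ, ‖a‖ₑ ^ 2 = ENNReal.ofReal (a ^ 2) := fun a => by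
    rw [← enorm_pow, Real.enorm_of_nonneg (sq_nonneg a)]
  simp only [h3] at h2
  rw [← ofReal_integral_eq_lintegral_ofReal hint (Filter.Eventually.of_forall fun _ => sq_nonneg _)]
    at h2
  have h4 := (ENNReal.sum_le_tsum S).trans h2
  rw [← ENNReal.ofReal_sum_of_nonneg (fun _ _ => sq_nonneg _)] at h4
  have h5 : (C : ℝ≥0∞) ^ 2 = ENNReal.ofReal ((C : ℝ) ^ 2) := by
    rw [ENNReal.ofReal_pow C.coe_nonneg, ENNReal.ofReal_coe_nnreal]
  have hnn : 0 ≤ ∫ x, interp φ v x ^ 2 := integral_nonneg fun _ => sq_nonneg _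
  rw [h5, ← ENNReal.ofReal_mul (by positivity),
    ENNReal.ofReal_le_ofReal_iff (by positivity)] at h4
  linarith

end Coercive

/-! ### The convolution action of the group algebra on lattice functions -/

section Conv

variable {G E : Type*} [AddCommGroup G] [AddCommGroup E] [Module ℝ E]

/-- Translations act on functions on a group. -/
def shift (G E : Type*) [AddCommGroup G] [AddCommGroup E] [Module ℝ E] :
    Multiplicative G →* Module.End ℝ (G → E) where
  toFun g :=
    { toFun := fun u ξ => u (ξ - g.toAdd)
      map_add' := fun _ _ => rfl
      map_smul' := fun _ _ => rfl }
  map_one' := by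
    ext u ξ
    simp
  map_mul' g h := by
    ext u ξ
    simp [sub_sub]

/-- The convolution action of the group algebra on functions on the group. -/
noncomputable def conv (G E : Type*) [AddCommGroup G] [AddCommGroup E] [Module ℝ E] :
    AddMonoidAlgebra ℝ G →ₐ[ℝ] Module.End ℝ (G → E) :=
  AddMonoidAlgebra.lift ℝ (Module.End ℝ (G → E)) G (shift G E)

theorem conv_apply (t : AddMonoidAlgebra ℝ G) (u : G → E) (ξ : G) :
    conv G E t u ξ = ∑ η ∈ t.coeff.support, t.coeff η • u (ξ - η) := by
  rw [conv, AddMonoidAlgebra.lift_apply, Finsupp.sum, LinearMap.sum_apply, Finset.sum_apply]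
  rfl

theorem conv_delta [DecidableEq G] (t : AddMonoidAlgebra ℝ G) (ξ : G) :
    conv G ℝ t (Pi.single 0 1) ξ = t.coeff ξ := by
  rw [conv_apply, Finset.sum_eq_single ξ]
  · simp
  · intro η _ hη
    rw [Pi.single_eq_of_ne (sub_ne_zero.2 hη.symm), smul_zero]
  · intro h
    rw [Finsupp.notMem_support_iff.1 h, zero_smul]

theorem conv_diff (t : AddMonoidAlgebra ℝ G) (u : G → E) (ρ ξ : G) :
    conv G E t u (ξ + ρ) - conv G E t u ξ = conv G E t (fun η => u (η + ρ) - u η) ξ := by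
  simp only [conv_apply, ← Finset.sum_sub_distrib, ← smul_sub, sub_add_eq_add_sub]

end Conv

/-! ### Geometric decay of the coefficients of `(1 - θ a)^n` -/

section Contraction

variable {G : Type*} [AddCommGroup G]

/-- Cauchy–Schwarz over the support of `a`, then translation invariance of the `ℓ²` norm. Any finite
constant suffices. -/
theorem sum_sq_conv_le [DecidableEq G] (a : AddMonoidAlgebra ℝ G) {v : G → ℝ} {T : Finset G}
    (hT : ∀ ξ ∉ T, v ξ = 0) (T' : Finset G) :
    ∑ ξ ∈ T', conv G ℝ a v ξ ^ 2 ≤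
      ((∑ η ∈ a.coeff.support, a.coeff η ^ 2) * a.coeff.support.card) * ∑ ξ ∈ T, v ξ ^ 2 := by
  have hsupp : ∀ ξ ∉ T, v ξ ^ 2 = 0 := fun ξ hξ => by rw [hT ξ hξ, sq, zero_mul]
  have hsum : Summable fun ξ => v ξ ^ 2 := summable_of_ne_finset_zero hsupp
  have htr : ∀ η, ∑ ξ ∈ T', v (ξ - η) ^ 2 ≤ ∑ ξ ∈ T, v ξ ^ 2 := fun η => by
    rw [← tsum_eq_sum (L := SummationFilter.unconditional G) hsupp,
      ← (Equiv.subRight η).tsum_eq (fun ξ => v ξ ^ 2)]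
    exact ((Equiv.subRight η).summable_iff.2 hsum).sum_le_tsum T' fun _ _ => sq_nonneg _
  calc ∑ ξ ∈ T', conv G ℝ a v ξ ^ 2
      ≤ ∑ ξ ∈ T', (∑ η ∈ a.coeff.support, a.coeff η ^ 2) *
          ∑ η ∈ a.coeff.support, v (ξ - η) ^ 2 := by
        refine Finset.sum_le_sum fun ξ _ => ?_
        rw [conv_apply]
        exact Finset.sum_mul_sq_le_sq_mul_sq _ _ _
    _ = (∑ η ∈ a.coeff.support, a.coeff η ^ 2) *
          ∑ η ∈ a.coeff.support, ∑ ξ ∈ T', v (ξ - η) ^ 2 := by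
        rw [← Finset.mul_sum, Finset.sum_comm]
    _ ≤ (∑ η ∈ a.coeff.support, a.coeff η ^ 2) *
          ∑ η ∈ a.coeff.support, ∑ ξ ∈ T, v ξ ^ 2 := by
        gcongr with η _
        exact htr η
    _ = _ := by rw [Finset.sum_const, nsmul_eq_mul, mul_assoc]

/-- If convolution with `a` is coercive in `ℓ²`, then the coefficients of the powers of `1 - θ a`
decay geometrically for suitable `θ > 0`. -/
theorem exists_coeff_pow_le [DecidableEq G] (a : AddMonoidAlgebra ℝ G) {c : ℝ} (hc : 0 < c)
    (hcoer : ∀ (v : G → ℝ) (S : Finset G), (∀ ξ ∉ S, v ξ = 0) →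
      c * ∑ ξ ∈ S, v ξ ^ 2 ≤ ∑ ξ ∈ S, v ξ * conv G ℝ a v ξ) :
    ∃ θ q : ℝ, 0 < θ ∧ 0 < q ∧ q < 1 ∧
      ∀ (n : ℕ) (ξ : G), |((1 - θ • a) ^ n).coeff ξ| ≤ q ^ n := by
  set B : ℝ := (∑ η ∈ a.coeff.support, a.coeff η ^ 2) * a.coeff.support.card with hB
  have hB0 : 0 ≤ B := by positivity
  -- Expanding the square bounds `‖v - θ a ∗ v‖²` by `(1 - 2θc + θ²B) ‖v‖²`. Since `θB ≤ c`, the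
  -- factor is at most `1 - θc = κ`; this choice of `θ` also keeps `κ` strictly between zero and
  -- one.
  set θ : ℝ := c / (B + c ^ 2 + 1) with hθ
  have hθ0 : 0 < θ := by positivity
  set κ : ℝ := (B + 1) / (B + c ^ 2 + 1) with hκ
  have hκ0 : 0 < κ := by positivity
  have hκ1 : κ < 1 := by
    rw [hκ, div_lt_one (by positivity)]
    have : 0 < c ^ 2 := by positivity
    linarith
  have hκle : 1 - 2 * θ * c + θ ^ 2 * B ≤ κ := by
    have h1 : θ * (B + c ^ 2 + 1) = c := by rw [hθ]; field_simp
    have h2 : κ = 1 - θ * c := by rw [hκ, hθ]; field_simp; ring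
    rw [h2]
    nlinarith [mul_pos hθ0 hθ0, mul_nonneg (mul_pos hθ0 hθ0).le (sq_nonneg c)]
  have step : ∀ (v : G → ℝ) (S : Finset G), (∀ ξ ∉ S, v ξ = 0) →
      ∃ T : Finset G, (∀ ξ ∉ T, conv G ℝ (1 - θ • a) v ξ = 0) ∧
        ∑ ξ ∈ T, conv G ℝ (1 - θ • a) v ξ ^ 2 ≤ κ * ∑ ξ ∈ S, v ξ ^ 2 := by
    intro v S hS
    have hexp : ∀ ξ, conv G ℝ (1 - θ • a) v ξ = v ξ - θ * conv G ℝ a v ξ := fun ξ => by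
      rw [map_sub, map_one, map_smul]
      rfl
    set T : Finset G := S ∪ Finset.image₂ (· + ·) S a.coeff.support with hTdef
    have hST : S ⊆ T := Finset.subset_union_left
    have hvT : ∀ ξ ∉ T, v ξ = 0 := fun ξ hξ => hS ξ fun h => hξ (hST h)
    have hsum : ∑ ξ ∈ T, v ξ ^ 2 = ∑ ξ ∈ S, v ξ ^ 2 :=
      (Finset.sum_subset hST fun ξ _ h => by rw [hS ξ h, sq, zero_mul]).symm
    refine ⟨T, fun ξ hξ => ?_, ?_⟩
    · rw [hexp, hvT ξ hξ, conv_apply, Finset.sum_eq_zero, mul_zero, sub_zero]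
      intro η hη
      rw [hS, smul_zero]
      intro h
      refine hξ (Finset.mem_union_right _ (Finset.mem_image₂.2 ⟨_, h, _, hη, ?_⟩))
      exact sub_add_cancel ξ η
    · have h1 := hcoer v T hvT
      have h2 := sum_sq_conv_le a hvT T
      rw [hsum] at h1 h2
      calc ∑ ξ ∈ T, conv G ℝ (1 - θ • a) v ξ ^ 2
          = ∑ ξ ∈ T, v ξ ^ 2 - 2 * θ * ∑ ξ ∈ T, v ξ * conv G ℝ a v ξ +
              θ ^ 2 * ∑ ξ ∈ T, conv G ℝ a v ξ ^ 2 := by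
            rw [Finset.mul_sum, Finset.mul_sum, ← Finset.sum_sub_distrib, ← Finset.sum_add_distrib]
            refine Finset.sum_congr rfl fun ξ _ => ?_
            rw [hexp]
            ring
        _ ≤ ∑ ξ ∈ S, v ξ ^ 2 - 2 * θ * (c * ∑ ξ ∈ S, v ξ ^ 2) +
              θ ^ 2 * (B * ∑ ξ ∈ S, v ξ ^ 2) := by
            rw [hsum]
            gcongr
        _ = (1 - 2 * θ * c + θ ^ 2 * B) * ∑ ξ ∈ S, v ξ ^ 2 := by ring
        _ ≤ κ * ∑ ξ ∈ S, v ξ ^ 2 := by gcongr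
  have main : ∀ n : ℕ, ∃ T : Finset G,
      (∀ ξ ∉ T, conv G ℝ ((1 - θ • a) ^ n) (Pi.single 0 1) ξ = 0) ∧
        ∑ ξ ∈ T, conv G ℝ ((1 - θ • a) ^ n) (Pi.single 0 1) ξ ^ 2 ≤ κ ^ n := by
    intro n
    induction n with
    | zero =>
      refine ⟨{0}, fun ξ hξ => ?_, ?_⟩
      · rw [pow_zero, map_one, Module.End.one_apply,
          Pi.single_eq_of_ne (by simpa using hξ)]
      · simp
    | succ n ih =>
      obtain ⟨S, hS1, hS2⟩ := ih
      obtain ⟨T, hT1, hT2⟩ := step _ S hS1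
      have h : conv G ℝ ((1 - θ • a) ^ (n + 1)) (Pi.single 0 1) =
          conv G ℝ (1 - θ • a) (conv G ℝ ((1 - θ • a) ^ n) (Pi.single 0 1)) := by
        rw [pow_succ', map_mul, Module.End.mul_apply]
      rw [h]
      refine ⟨T, hT1, hT2.trans ?_⟩
      rw [pow_succ']
      gcongr
  refine ⟨θ, Real.sqrt κ, hθ0, Real.sqrt_pos.2 hκ0, ?_, fun n ξ => ?_⟩
  · rw [Real.sqrt_lt' one_pos, one_pow]
    exact hκ1
  · rw [← conv_delta]
    obtain ⟨T, hT1, hT2⟩ := main n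
    by_cases hξ : ξ ∈ T
    · refine abs_le_of_sq_le_sq ?_ (by positivity)
      rw [← pow_mul, mul_comm, pow_mul, Real.sq_sqrt hκ0.le]
      exact (Finset.single_le_sum (fun _ _ => sq_nonneg _) hξ).trans hT2
    · rw [hT1 ξ hξ, abs_zero]
      positivity

end Contraction

/-! ### Weighted summability of the Neumann series -/

section Neumann

theorem exists_subset_window (S : Finset (Fin d → ℤ)) : ∃ N : ℕ, S ⊆ window d N := by
  refine ⟨∑ ξ ∈ S, ∑ i, (ξ i).natAbs, fun ξ hξ => mem_window.2 fun i => ?_⟩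
  have h1 : (ξ i).natAbs ≤ ∑ i, (ξ i).natAbs :=
    Finset.single_le_sum (f := fun i => (ξ i).natAbs) (fun _ _ => Nat.zero_le _) (Finset.mem_univ i)
  have h2 : ∑ i, (ξ i).natAbs ≤ ∑ ξ ∈ S, ∑ i, (ξ i).natAbs :=
    Finset.single_le_sum (f := fun ξ : Fin d → ℤ => ∑ i, (ξ i).natAbs)
      (fun _ _ => Nat.zero_le _) hξ
  rw [Int.abs_eq_natAbs]
  exact_mod_cast h1.trans h2

theorem support_pow_subset_window {t : AddMonoidAlgebra ℝ (Fin d → ℤ)} {N : ℕ}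
    (ht : t.coeff.support ⊆ window d N) (n : ℕ) :
    (t ^ n).coeff.support ⊆ window d (n * N) := by
  induction n with
  | zero =>
    intro ξ hξ
    rw [pow_zero, AddMonoidAlgebra.one_def, AddMonoidAlgebra.coeff_single] at hξ
    rw [Finset.mem_singleton.1 (Finsupp.support_single_subset hξ), mem_window]
    simp
  | succ n ih =>
    intro ξ hξ
    rw [pow_succ] at hξ
    obtain ⟨η, hη, σ, hσ, rfl⟩ := Finset.mem_add.1 (AddMonoidAlgebra.support_coeff_mul_subset _ _ hξ)
    have h1 := mem_window.1 (ih hη)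
    have h2 := mem_window.1 (ht hσ)
    rw [mem_window]
    intro i
    have h3 := abs_add_le (η i) (σ i)
    have h4 := h1 i
    have h5 := h2 i
    rw [Pi.add_apply]
    push_cast at h4 ⊢
    linarith

/-- The Neumann series of a coercive convolution operator converges absolutely in a weighted
`ℓ¹`-norm. -/
theorem exists_summable_norm_pow (a : AddMonoidAlgebra ℝ (Fin d → ℤ)) {c : ℝ} (hc : 0 < c)
    (hcoer : ∀ (v : (Fin d → ℤ) → ℝ) (S : Finset (Fin d → ℤ)), (∀ ξ ∉ S, v ξ = 0) →
      c * ∑ ξ ∈ S, v ξ ^ 2 ≤ ∑ ξ ∈ S, v ξ * conv (Fin d → ℤ) ℝ a v ξ) :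
    ∃ (θ : ℝ) (β : ℕ → ℝ), 0 < θ ∧ Summable β ∧ ∀ n : ℕ,
      ((n : ℝ) + 1) * ∑ η ∈ ((1 - θ • a) ^ n).coeff.support, |((1 - θ • a) ^ n).coeff η| ≤ β n := by
  obtain ⟨θ, q, hθ, hq0, hq1, hq⟩ := exists_coeff_pow_le a hc hcoer
  obtain ⟨N, hN⟩ := exists_subset_window (1 - θ • a).coeff.support
  -- The power `d` comes from the size of the window containing the support, the extra one from the
  -- weight `n + 1`.
  have hs : Summable fun n : ℕ => ((n : ℝ) + 1) ^ (d + 1) * q ^ n := by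
    have h1 := (summable_nat_add_iff 1).2
      (summable_pow_mul_geometric_of_norm_lt_one (R := ℝ) (d + 1) (r := q)
        (by rwa [Real.norm_of_nonneg hq0.le]))
    refine (h1.mul_right q⁻¹).congr fun n => ?_
    rw [pow_succ q n, mul_assoc, mul_assoc, mul_inv_cancel₀ hq0.ne', mul_one]
    push_cast
    rfl
  refine ⟨θ, fun n => (2 * N + 1) ^ d * (((n : ℝ) + 1) ^ (d + 1) * q ^ n), hθ, hs.mul_left _,
    fun n => ?_⟩
  have h1 : ∑ η ∈ ((1 - θ • a) ^ n).coeff.support, |((1 - θ • a) ^ n).coeff η| ≤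
      ((2 * (n * N) + 1) ^ d : ℝ) * q ^ n := by
    calc ∑ η ∈ ((1 - θ • a) ^ n).coeff.support, |((1 - θ • a) ^ n).coeff η|
        ≤ ∑ η ∈ window d (n * N), |((1 - θ • a) ^ n).coeff η| :=
          Finset.sum_le_sum_of_subset_of_nonneg (support_pow_subset_window hN n)
            fun _ _ _ => abs_nonneg _
      _ ≤ ∑ η ∈ window d (n * N), q ^ n := Finset.sum_le_sum fun η _ => hq n η
      _ = _ := by
        rw [Finset.sum_const, card_window, nsmul_eq_mul]
        push_cast
        rfl
  have h2 : (2 * ((n : ℝ) * N) + 1) ^ d ≤ ((2 * N + 1) * ((n : ℝ) + 1)) ^ d := by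
    refine pow_le_pow_left₀ (by positivity) ?_ d
    have : (0 : ℝ) ≤ N := N.cast_nonneg
    have : (0 : ℝ) ≤ n := n.cast_nonneg
    nlinarith
  calc ((n : ℝ) + 1) * ∑ η ∈ ((1 - θ • a) ^ n).coeff.support, |((1 - θ • a) ^ n).coeff η|
      ≤ ((n : ℝ) + 1) * (((2 * N + 1) * ((n : ℝ) + 1)) ^ d * q ^ n) := by
        gcongr
        exact h1.trans (by gcongr)
    _ = _ := by rw [mul_pow]; ring

end Neumann

/-- Functions with bounded finite differences. -/
def BddDiff {G E : Type*} [Add G] [NormedAddCommGroup E] (u : G → E) : Prop :=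
  ∀ ρ, ∃ B : ℝ, ∀ ξ, ‖u (ξ + ρ) - u ξ‖ ≤ B

/-! ### Inversion on functions with bounded differences -/

section Inverse

variable {G E : Type*} [AddCommGroup G] [NormedAddCommGroup E]

theorem BddDiff.sub {u v : G → E} (hu : BddDiff u) (hv : BddDiff v) : BddDiff (u - v) := by
  intro ρ
  obtain ⟨B, hB⟩ := hu ρ
  obtain ⟨B', hB'⟩ := hv ρ
  refine ⟨B + B', fun ξ => ?_⟩
  have h : (u - v) (ξ + ρ) - (u - v) ξ = (u (ξ + ρ) - u ξ) - (v (ξ + ρ) - v ξ) := by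
    simp only [Pi.sub_apply]
    abel
  rw [h]
  exact (norm_sub_le _ _).trans (add_le_add (hB ξ) (hB' ξ))

/-- An element of the support of `t ^ n` is a sum of `n` elements of the support of `t`, so the
increment telescopes into `n` bounded steps. The weight `n + 1` absorbs this linear growth. -/
theorem BddDiff.exists_norm_sub_le [DecidableEq G] {u : G → E} (hu : BddDiff u)
    (t : AddMonoidAlgebra ℝ G) :
    ∃ B : ℝ, 0 ≤ B ∧ ∀ (n : ℕ), ∀ η ∈ (t ^ n).coeff.support, ∀ ξ, ‖u (ξ - η) - u ξ‖ ≤ n * B := by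
  choose b hb using fun ρ => hu (-ρ)
  have hb0 : ∀ ρ, 0 ≤ b ρ := fun ρ => (norm_nonneg _).trans (hb ρ 0)
  have hB : ∀ η ∈ t.coeff.support, b η ≤ ∑ η ∈ t.coeff.support, b η := fun η hη =>
    Finset.single_le_sum (fun η _ => hb0 η) hη
  refine ⟨∑ η ∈ t.coeff.support, b η, Finset.sum_nonneg fun η _ => hb0 η, fun n => ?_⟩
  induction n with
  | zero =>
    intro η hη ξ
    rw [pow_zero, AddMonoidAlgebra.one_def, AddMonoidAlgebra.coeff_single] at hη
    rw [Finset.mem_singleton.1 (Finsupp.support_single_subset hη)]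
    simp
  | succ n ih =>
    intro ρ hρ ξ
    rw [pow_succ] at hρ
    obtain ⟨η, hη, σ, hσ, rfl⟩ := Finset.mem_add.1 (AddMonoidAlgebra.support_coeff_mul_subset _ _ hρ)
    have h1 := ih η hη (ξ - σ)
    have h2 := (hb σ ξ).trans (hB σ hσ)
    have h3 : u (ξ - (η + σ)) - u ξ = (u (ξ - σ - η) - u (ξ - σ)) + (u (ξ + -σ) - u ξ) := by
      rw [← sub_eq_add_neg, sub_add_sub_cancel, sub_sub, add_comm σ η]
    rw [h3]
    refine (norm_add_le _ _).trans ?_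
    push_cast
    linarith

variable [NormedSpace ℝ E]

theorem BddDiff.exists_norm_conv_pow_le {u : G → E} (hu : BddDiff u)
    {t : AddMonoidAlgebra ℝ G} {β : ℕ → ℝ}
    (hβ : ∀ n : ℕ, ((n : ℝ) + 1) * ∑ η ∈ (t ^ n).coeff.support, |(t ^ n).coeff η| ≤ β n) (ξ : G) :
    ∃ A : ℝ, ∀ n, ‖conv G E (t ^ n) u ξ‖ ≤ β n * A := by
  classical
  obtain ⟨B, hB0, hB⟩ := hu.exists_norm_sub_le t
  refine ⟨‖u ξ‖ + B, fun n => ?_⟩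
  rw [conv_apply]
  calc ‖∑ η ∈ (t ^ n).coeff.support, (t ^ n).coeff η • u (ξ - η)‖
      ≤ ∑ η ∈ (t ^ n).coeff.support, |(t ^ n).coeff η| * (((n : ℝ) + 1) * (‖u ξ‖ + B)) := by
        refine (norm_sum_le _ _).trans (Finset.sum_le_sum fun η hη => ?_)
        rw [norm_smul, Real.norm_eq_abs]
        gcongr
        have h1 := hB n η hη ξ
        have h2 := norm_le_norm_add_norm_sub' (u (ξ - η)) (u ξ)
        have h3 : 0 ≤ (n : ℝ) * ‖u ξ‖ := by positivity
        linarith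
    _ = (((n : ℝ) + 1) * ∑ η ∈ (t ^ n).coeff.support, |(t ^ n).coeff η|) * (‖u ξ‖ + B) := by
        rw [← Finset.sum_mul]
        ring
    _ ≤ β n * (‖u ξ‖ + B) := by
        gcongr
        exact hβ n

open Filter Topology

theorem BddDiff.tendsto_conv_pow {u : G → E} (hu : BddDiff u)
    {t : AddMonoidAlgebra ℝ G} {β : ℕ → ℝ} (hsum : Summable β)
    (hβ : ∀ n : ℕ, ((n : ℝ) + 1) * ∑ η ∈ (t ^ n).coeff.support, |(t ^ n).coeff η| ≤ β n) (ξ : G) :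
    Tendsto (fun n => conv G E (t ^ n) u ξ) atTop (𝓝 0) := by
  obtain ⟨A, hA⟩ := hu.exists_norm_conv_pow_le hβ ξ
  refine squeeze_zero_norm hA ?_
  simpa using hsum.tendsto_atTop_zero.mul_const A

/-- Every power of `1 - θ a` fixes such a `u`, while these powers applied to `u` tend to zero
pointwise. -/
theorem BddDiff.eq_zero_of_conv_eq_zero {u : G → E} (hu : BddDiff u)
    {a : AddMonoidAlgebra ℝ G} {θ : ℝ} {β : ℕ → ℝ} (hsum : Summable β)
    (hβ : ∀ n : ℕ, ((n : ℝ) + 1) * ∑ η ∈ ((1 - θ • a) ^ n).coeff.support,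
      |((1 - θ • a) ^ n).coeff η| ≤ β n) (h : conv G E a u = 0) : u = 0 := by
  have h1 : ∀ n : ℕ, conv G E ((1 - θ • a) ^ n) u = u := by
    intro n
    induction n with
    | zero => rw [pow_zero, map_one, Module.End.one_apply]
    | succ n ih =>
      rw [pow_succ, map_mul, Module.End.mul_apply, map_sub, map_one, map_smul, LinearMap.sub_apply,
        LinearMap.smul_apply, h, smul_zero, sub_zero, Module.End.one_apply, ih]
  ext ξ
  have h2 := hu.tendsto_conv_pow hsum hβ ξ
  simp only [h1] at h2
  exact tendsto_const_nhds_iff.1 h2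

theorem eLpNorm_conv_le [Countable G] [MeasurableSpace G] [DiscreteMeasurableSpace G] {p : ℝ≥0∞}
    (hp : 1 ≤ p) (hp' : p ≠ ⊤) (t : AddMonoidAlgebra ℝ G) (u : G → E) :
    eLpNorm (conv G E t u) p Measure.count ≤
      ENNReal.ofReal (∑ η ∈ t.coeff.support, |t.coeff η|) * eLpNorm u p Measure.count := by
  have h1 : conv G E t u = ∑ η ∈ t.coeff.support, t.coeff η • fun ξ => u (ξ + -η) := by
    ext ξ
    rw [conv_apply, Finset.sum_apply]
    simp only [Pi.smul_apply, sub_eq_add_neg]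
  rw [h1, ENNReal.ofReal_sum_of_nonneg fun _ _ => abs_nonneg _, Finset.sum_mul]
  refine (eLpNorm_sum_le (fun η _ => StronglyMeasurable.of_discrete.aestronglyMeasurable) hp).trans
    (Finset.sum_le_sum fun η _ => le_of_eq ?_)
  rw [eLpNorm_const_smul, eLpNorm_count_comp_add hp hp', Real.enorm_eq_ofReal_abs]

/-- The Neumann series inverts convolution on functions with bounded differences, with uniform
`ℓ^p`-bounds on finite differences. -/
theorem BddDiff.exists_conv_eq [CompleteSpace E] [Countable G] [MeasurableSpace G]
    [DiscreteMeasurableSpace G]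
    {u : G → E} (hu : BddDiff u)
    {a : AddMonoidAlgebra ℝ G} {θ : ℝ} (hθ : 0 < θ) {β : ℕ → ℝ} (hsum : Summable β)
    (hβ : ∀ n : ℕ, ((n : ℝ) + 1) * ∑ η ∈ ((1 - θ • a) ^ n).coeff.support,
      |((1 - θ • a) ^ n).coeff η| ≤ β n) :
    ∃ w : G → E, conv G E a w = u ∧ ∀ p : ℝ≥0∞, 1 ≤ p → p ≠ ⊤ → ∀ ρ,
      eLpNorm (fun ξ => w (ξ + ρ) - w ξ) p Measure.count ≤
        ENNReal.ofReal (θ * ∑' n, β n) * eLpNorm (fun ξ => u (ξ + ρ) - u ξ) p Measure.count := by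
  set t := 1 - θ • a with ht
  set s : ℕ → AddMonoidAlgebra ℝ G := fun N => θ • ∑ n ∈ Finset.range N, t ^ n with hs
  have hβ0 : ∀ n, ∑ η ∈ (t ^ n).coeff.support, |(t ^ n).coeff η| ≤ β n := fun n => by
    refine le_trans ?_ (hβ n)
    have h0 : 0 ≤ ∑ η ∈ (t ^ n).coeff.support, |(t ^ n).coeff η| :=
      Finset.sum_nonneg fun _ _ => abs_nonneg _
    have h1 : (0 : ℝ) ≤ n := n.cast_nonneg
    nlinarith
  have hβnn : ∀ n, 0 ≤ β n := fun n => (Finset.sum_nonneg fun _ _ => abs_nonneg _).trans (hβ0 n)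
  have hconvs : ∀ (N : ℕ) (g : G → E), conv G E (s N) g =
      θ • ∑ n ∈ Finset.range N, conv G E (t ^ n) g := fun N g => by
    rw [hs, map_smul, map_sum, LinearMap.smul_apply, LinearMap.sum_apply]
  have hlim : ∀ ξ, Tendsto (fun N => conv G E (s N) u ξ) atTop
      (𝓝 (θ • ∑' n, conv G E (t ^ n) u ξ)) := fun ξ => by
    obtain ⟨A, hA⟩ := hu.exists_norm_conv_pow_le hβ ξ
    have h1 : Summable fun n => conv G E (t ^ n) u ξ :=
      Summable.of_norm_bounded (hsum.mul_right A) hA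
    have h2 := h1.hasSum.tendsto_sum_nat.const_smul θ
    refine h2.congr fun N => ?_
    rw [hconvs, Pi.smul_apply, Finset.sum_apply]
  refine ⟨fun ξ => θ • ∑' n, conv G E (t ^ n) u ξ, ?_, fun p hp hp' ρ => ?_⟩
  · ext ξ
    have h1 : Tendsto (fun N => conv G E a (conv G E (s N) u) ξ) atTop
        (𝓝 (conv G E a (fun ξ => θ • ∑' n, conv G E (t ^ n) u ξ) ξ)) := by
      simp only [conv_apply a]
      exact tendsto_finsetSum _ fun η _ => (hlim (ξ - η)).const_smul _
    -- The geometric sum telescopes to `a * s N = 1 - t ^ N`, and the remainder tends to zero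
    -- pointwise.
    have h2 : ∀ N, conv G E a (conv G E (s N) u) ξ = u ξ - conv G E (t ^ N) u ξ := fun N => by
      have h3 : a * s N = 1 - t ^ N := by
        rw [← mul_neg_geom_sum, hs, mul_smul_comm, ← smul_mul_assoc, ht, sub_sub_cancel]
      rw [← Module.End.mul_apply, ← map_mul, h3, map_sub, map_one]
      rfl
    simp only [h2] at h1
    have h4 := (hu.tendsto_conv_pow hsum hβ ξ).const_sub (u ξ)
    rw [sub_zero] at h4
    exact tendsto_nhds_unique h1 h4
  · set g : G → E := fun ξ => u (ξ + ρ) - u ξ with hg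
    have h1 : ∀ N, eLpNorm (conv G E (s N) g) p Measure.count ≤
        ENNReal.ofReal (θ * ∑' n, β n) * eLpNorm g p Measure.count := fun N => by
      rw [hconvs, eLpNorm_const_smul, ENNReal.ofReal_mul hθ.le, Real.enorm_of_nonneg hθ.le,
        mul_assoc]
      gcongr
      calc eLpNorm (∑ n ∈ Finset.range N, conv G E (t ^ n) g) p Measure.count
          ≤ ∑ n ∈ Finset.range N, eLpNorm (conv G E (t ^ n) g) p Measure.count :=
            eLpNorm_sum_le
              (fun _ _ => StronglyMeasurable.of_discrete.aestronglyMeasurable) hp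
        _ ≤ ∑ n ∈ Finset.range N, ENNReal.ofReal (β n) * eLpNorm g p Measure.count := by
            refine Finset.sum_le_sum fun n _ => (eLpNorm_conv_le hp hp' _ g).trans ?_
            gcongr
            exact hβ0 n
        _ ≤ ENNReal.ofReal (∑' n, β n) * eLpNorm g p Measure.count := by
            rw [← Finset.sum_mul, ← ENNReal.ofReal_sum_of_nonneg fun n _ => hβnn n]
            gcongr
            exact hsum.sum_le_tsum _ fun n _ => hβnn n
    -- Fatou: convolution commutes with differences, so the difference of `w` is the pointwise limit
    -- of `s N` acting on the difference of `u`, and the uniform bound passes to the limit.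
    refine (Lp.eLpNorm_lim_le_liminf_eLpNorm (f := fun N => conv G E (s N) g)
      (fun _ => StronglyMeasurable.of_discrete.aestronglyMeasurable) _
      (Eventually.of_forall fun ξ => ?_)).trans
      (liminf_le_of_frequently_le' (Frequently.of_forall h1))
    rw [hg]
    simp only [← conv_diff]
    exact (hlim (ξ + ρ)).sub (hlim ξ)

end Inverse

/-! ### Nodal values as an element of the group algebra -/

section Nodal

variable {φ : EuclideanSpace ℝ (Fin d) → ℝ} {R : ℕ}

/-- The nodal values of a compactly supported function act by convolution as the nodal values of
the interpolant. -/
theorem exists_conv_eq_interp (hR : ∀ x, (R : ℝ) ≤ ‖x‖ → φ x = 0) :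
    ∃ a : AddMonoidAlgebra ℝ (Fin d → ℤ), ∀ (F : Type) [NormedAddCommGroup F] [NormedSpace ℝ F]
      (v : (Fin d → ℤ) → F) (ξ : Fin d → ℤ),
      conv (Fin d → ℤ) F a v ξ = interp φ v (latticePt ξ) := by
  refine ⟨.ofCoeff (Finsupp.onFinset (window d R) (fun ξ => φ (latticePt ξ)) fun ξ hξ => ?_),
    fun F _ _ v ξ => ?_⟩
  · by_contra h
    have h1 := apply_sub_latticePt_eq_zero hR (x := 0) (N := R) (by simp)
      (ξ := -ξ) (fun h' => h ?_)
    · rw [latticePt_neg, zero_sub, neg_neg] at h1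
      exact hξ h1
    · rw [mem_window] at h' ⊢
      simpa using h'
  · rw [conv_apply, interp, ← (Equiv.subLeft ξ).tsum_eq]
    refine (tsum_eq_sum fun η hη => ?_).symm.trans (tsum_congr fun η => ?_)
    · rw [Finsupp.notMem_support_iff.1 hη, zero_smul]
    · simp only [Equiv.subLeft_apply, latticePt_sub, sub_sub_cancel]
      rfl

end Nodal

/-! ### `ℓ^p` norms of finite differences -/

section Diff

variable {G E : Type*} [AddCommGroup G] [NormedAddCommGroup E] [MeasurableSpace G]
  [MeasurableSingletonClass G]

/-- The `ℓ^p`-norm of a finite difference. -/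
noncomputable def diffNorm (p : ℝ≥0∞) (u : G → E) (ρ : G) : ℝ≥0∞ :=
  eLpNorm (fun ξ => u (ξ + ρ) - u ξ) p Measure.count

/-- For counting measure, `ℓ^p` embeds in `ℓ^∞`. This places every discrete Sobolev space inside the
one class on which the Neumann series converges. -/
theorem bddDiff_of_diffNorm_lt_top {p : ℝ≥0∞} (hp : 1 ≤ p) (hp' : p ≠ ⊤) {u : G → E}
    (h : ∀ ρ, diffNorm p u ρ < ⊤) : BddDiff u := fun ρ => by
  refine ⟨(diffNorm p u ρ).toReal, fun ξ => ?_⟩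
  rw [← toReal_enorm]
  exact ENNReal.toReal_mono (h ρ).ne
    (enorm_apply_le_eLpNorm_count hp hp' (fun ξ => u (ξ + ρ) - u ξ) ξ)

end Diff

theorem le_mul_of_le_mul_sum {ι : Type*} {S : Finset ι} {x y : ℝ≥0∞} {D : ι → ℝ≥0∞} {K : ℝ≥0}
    {C : ι → ℝ≥0} (h1 : x ≤ K * ∑ i ∈ S, D i) (h2 : ∀ i, D i ≤ C i * y) :
    x ≤ (K * ∑ i ∈ S, C i : ℝ≥0) * y := by
  refine h1.trans ?_
  push_cast
  rw [mul_assoc, Finset.sum_mul]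
  gcongr with i _
  exact h2 i

/-- The analytic facts on the discrete convolution, with constants independent of the exponent. -/
theorem exists_gradNorm_bounds (m : ℕ) {ζ : EuclideanSpace ℝ (Fin d) → ℝ} (hζ : IsNodalBasis ζ)
    (hsymm : ∀ x, ζ (-x) = ζ x) :
    ∃ α₁ α₂ α₃ : ℝ≥0, ∀ p : ℝ≥0∞, 1 ≤ p → p ≠ ⊤ →
      (∀ u : LatticeFun d m,
        gradNorm p (quasiInterp ζ u) ≤ α₁ * gradNorm p (barInterp ζ u)) ∧
      (∀ u : LatticeFun d m,
        gradNorm p (barInterp ζ (latticeConv ζ u)) ≤ α₂ * gradNorm p (quasiInterp ζ u)) ∧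
      (∀ u : LatticeFun d m, u ∈ discSobolev ζ p → ∃ w : LatticeFun d m, latticeConv ζ w = u ∧
        gradNorm p (barInterp ζ w) ≤ α₃ * gradNorm p (barInterp ζ u)) ∧
      Set.InjOn (latticeConv ζ) (discSobolev ζ p : Set (LatticeFun d m)) := by
  obtain ⟨K, hK⟩ := hζ.regularity
  obtain ⟨R, hR⟩ : ∃ R : ℕ, ∀ x, (R : ℝ) ≤ ‖x‖ → ζ x = 0 := by
    obtain ⟨r, hr⟩ := hζ.locality.isCompact.isBounded.exists_norm_le
    obtain ⟨R, hR⟩ := exists_nat_gt r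
    refine ⟨R, fun x hx => ?_⟩
    by_contra h
    have := hr x (subset_tsupport ζ h)
    linarith
  have hsum : ∀ x, ∑' ξ, ζ (x - latticePt ξ) = 1 := fun x => by
    simpa using hζ.order 1 0 x
  obtain ⟨K', hK'⟩ := exists_lipschitzWith_selfConv hK hR
  have hR' := selfConv_eq_zero hR
  have hsum' := tsum_selfConv hK hR hsum
  obtain ⟨a, ha⟩ := exists_conv_eq_interp hR'
  obtain ⟨c, hc, hcoer⟩ := exists_coercive hK hR hsymm hζ.nodal_zero hζ.nodal_ne_zero
  obtain ⟨θ, β, hθ, hβs, hβ⟩ := exists_summable_norm_pow a hc (by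
    intro v S hS
    simp only [ha]
    exact hcoer v S hS)
  have hquasi : ∀ u : LatticeFun d m, quasiInterp ζ u = interp (selfConv ζ) u := fun u =>
    funext fun x => integral_smul_interp hK hR u x
  have hC : ∀ u : LatticeFun d m, latticeConv ζ u = conv (Fin d → ℤ) _ a u := fun u =>
    funext fun ξ => by rw [latticeConv, hquasi, ha]
  choose C₁ hC₁ using exists_eLpNorm_nodal_diff_le (EuclideanSpace ℝ (Fin m)) hK hR
  choose C₂ hC₂ using exists_eLpNorm_nodal_diff_le (EuclideanSpace ℝ (Fin m)) hK' hR'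
  obtain ⟨N₁, hN₁⟩ := exists_eLpNorm_fderiv_interp_le (F := EuclideanSpace ℝ (Fin m)) hK hR hsum
  obtain ⟨N₂, hN₂⟩ := exists_eLpNorm_fderiv_interp_le (F := EuclideanSpace ℝ (Fin m)) hK' hR' hsum'
  set γ : ℝ≥0 := (θ * ∑' n, β n).toNNReal with hγ
  have hbar : ∀ p : ℝ≥0∞, 1 ≤ p → p ≠ ⊤ → ∀ (u : LatticeFun d m) ρ,
      diffNorm p u ρ ≤ C₁ ρ * gradNorm p (barInterp ζ u) := fun p hp hp' u ρ => by
    have h := hC₁ ρ p hp hp' u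
    simp only [interp_latticePt hζ.nodal_zero hζ.nodal_ne_zero] at h
    exact h
  have hbdd : ∀ p : ℝ≥0∞, 1 ≤ p → p ≠ ⊤ → ∀ u : LatticeFun d m, u ∈ discSobolev ζ p →
      BddDiff u := fun p hp hp' u hu =>
    bddDiff_of_diffNorm_lt_top hp hp' fun ρ =>
      (hbar p hp hp' u ρ).trans_lt (ENNReal.mul_lt_top ENNReal.coe_lt_top hu)
  refine ⟨K' * ∑ ρ ∈ window d N₂, C₁ ρ, K * ∑ ρ ∈ window d N₁, C₂ ρ,
    K * ∑ ρ ∈ window d N₁, γ * C₁ ρ, fun p hp hp' => ⟨fun u => ?_, fun u => ?_, fun u hu => ?_,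
      fun u hu v hv huv => ?_⟩⟩
  · rw [hquasi]
    exact le_mul_of_le_mul_sum (hN₂ p hp hp' u) (hbar p hp hp' u)
  -- The nodal values of `ũ` are the coefficients of the interpolant of `C u`. Their differences are
  -- bounded by the gradient of `ũ`, since the local estimate holds for `ζ ∗ ζ` without any nodal
  -- condition.
  · refine le_mul_of_le_mul_sum (hN₁ p hp hp' (latticeConv ζ u)) fun ρ => ?_
    have h := hC₂ ρ p hp hp' u
    simp only [← hquasi] at h
    exact h
  · obtain ⟨w, hw, hwn⟩ := (hbdd p hp hp' u hu).exists_conv_eq hθ hβs hβ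
    refine ⟨w, (hC w).trans hw, le_mul_of_le_mul_sum (hN₁ p hp hp' w) fun ρ => ?_⟩
    refine (hwn p hp hp' ρ).trans ?_
    push_cast
    rw [mul_assoc]
    exact mul_le_mul' le_rfl (hbar p hp hp' u ρ)
  · refine sub_eq_zero.1 (((hbdd p hp hp' u hu).sub (hbdd p hp hp' v hv)).eq_zero_of_conv_eq_zero
      hβs hβ ?_)
    rw [map_sub, sub_eq_zero, ← hC, ← hC]
    exact huv

end LatticeInterp

/-! ### The main theorem -/

open LatticeInterp in
theorem lemma2p12 (d m : ℕ) (ζ : EuclideanSpace ℝ (Fin d) → ℝ)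
    (hζ : LatticeInterp.IsNodalBasis ζ) (hsymm : ∀ x, ζ (-x) = ζ x) :
    ∃ c₀ c₁ : ℝ, 0 < c₀ ∧ 0 < c₁ ∧
      ∀ p : ℝ≥0∞, 1 ≤ p → p ≠ ⊤ →
        Set.BijOn (LatticeInterp.latticeConv ζ)
          (LatticeInterp.discSobolev ζ p : Set (LatticeInterp.LatticeFun d m))
          (LatticeInterp.discSobolev ζ p) ∧
        ∀ u : LatticeInterp.LatticeFun d m, u ∈ LatticeInterp.discSobolev ζ p →
          ENNReal.ofReal c₀ * LatticeInterp.gradNorm p (LatticeInterp.barInterp ζ u) ≤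
              LatticeInterp.gradNorm p (LatticeInterp.smoothInterp ζ p u) ∧
            LatticeInterp.gradNorm p (LatticeInterp.smoothInterp ζ p u) ≤
              ENNReal.ofReal c₁ * LatticeInterp.gradNorm p (LatticeInterp.barInterp ζ u) := by
  obtain ⟨α₁, α₂, α₃, h⟩ := exists_gradNorm_bounds m hζ hsymm
  -- The lower bound comes from `u = C w` and the `α₂` estimate, the upper one from composing the
  -- `α₁` and `α₃` estimates. The added ones keep both constants positive.
  refine ⟨((α₂ : ℝ) + 1)⁻¹, α₁ * α₃ + 1, by positivity, by positivity, fun p hp hp' => ?_⟩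
  obtain ⟨hquasi, hbar, hinv, hinj⟩ := h p hp hp'
  have hbij : Set.BijOn (latticeConv ζ) (discSobolev ζ p : Set (LatticeFun d m))
      (discSobolev ζ p) := by
    refine ⟨fun u hu => ?_, hinj, fun u hu => ?_⟩
    · refine (hbar u).trans_lt (ENNReal.mul_lt_top ENNReal.coe_lt_top ?_)
      exact (hquasi u).trans_lt (ENNReal.mul_lt_top ENNReal.coe_lt_top hu)
    · obtain ⟨w, hw, hwn⟩ := hinv u hu
      exact ⟨w, hwn.trans_lt (ENNReal.mul_lt_top ENNReal.coe_lt_top hu), hw⟩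
  refine ⟨hbij, fun u hu => ?_⟩
  obtain ⟨w, hw, hwn⟩ := hinv u hu
  have hwmem : w ∈ discSobolev ζ p := hwn.trans_lt (ENNReal.mul_lt_top ENNReal.coe_lt_top hu)
  -- Injectivity identifies the chosen preimage with the Neumann solution `w`, which carries the
  -- bounds.
  have heq : Function.invFunOn (latticeConv ζ) (discSobolev ζ p) u = w := by
    rw [← hw]
    exact hinj.leftInvOn_invFunOn hwmem
  rw [smoothInterp, heq]
  constructor
  · have h1 := hbar w
    rw [hw] at h1
    rw [ENNReal.ofReal_inv_of_pos (by positivity),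
      ENNReal.inv_mul_le_iff (by simpa using by positivity) ENNReal.ofReal_ne_top]
    refine h1.trans (mul_le_mul' ?_ le_rfl)
    rw [← ENNReal.ofReal_coe_nnreal]
    exact ENNReal.ofReal_le_ofReal (by linarith)
  · refine ((hquasi w).trans (mul_le_mul' le_rfl hwn)).trans ?_
    rw [← mul_assoc]
    refine mul_le_mul' ?_ le_rfl
    rw [← ENNReal.coe_mul, ← ENNReal.ofReal_coe_nnreal]
    refine ENNReal.ofReal_le_ofReal ?_
    push_cast
    linarith
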